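/- For $N=2^n$ ($n\in\mathbb N$) let $V_N=\{0,\dots,N-1\}^2\subset\mathbb Z^2$ and let $|u-v|$ be the $\ell_\infty$-distance. For $j\ge 0$ let $\mathcal B_j$ be the set of boxes in $\mathbb Z^2$ consisting of $2^j\times 2^j$ lattice points (all translates by $\mathbb Z^2$), and let $\mathcal B_j(z)$ be the set of those containing $z$. Let $\{b_{j,B}: j\ge 0, B\in\mathcal B_j\}$ be independent centered Gaussian variables with $\operatorname{Var} b_{j,B}=2^{-2j}$. For $K=2^k$ with an integer $k\ge 1$, the $K$-coarse modified branching random walk is $$\varphi_{N,z}(K)=\sum_{j=0}^{\lfloor n/k\rfloor-1}\ \sum_{B\in\mathcal B_{jk}(z)}\sqrt{k}\, b_{jk,B},\qquad z\in V_N .$$ Let $q$ be a positive integer, $0<p\le 1$, and let $\{\xi_{N,w}:w\in V_N\}$ be a $\{0,1\}$-valued random field that is independent of $\{\varphi_{N,w}(K):w\in V_N\}$, is $q$-dependent (i.e. $\{\xi_{N,w}:w\in A\}$ and $\{\xi_{N,w}:w\in B\}$ are independent whenever $A,B\subset V_N$ and $|z-w|>q$ for all $z\in A$, $w\in B$), and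 satisfies $\mathbb P(\xi_{N,w}=1)\ge p$ for all $w\in V_N$. A path is a nearest-neighbour lattice path (self-avoiding or not); its diameter is the maximal $\ell_\infty$-distance of two vertices on it. **Theorem 1.2.** Let $\delta\in(0,1)$ and let $q$ be a positive integer. There exist $K_0=K_0(\delta,q)>0$ and $p_0=p_0(\delta,q)\in(0,1)$ such that for every $\kappa\in(0,\tfrac12\delta^2)$, every $K=2^k\ge K_0$ and every $p\in[p_0,1]$ the following holds for all sufficiently large $N=2^n$ (the threshold depending only on $\delta,q,\kappa,K,p$): with probability at least $1-6e^{-n/10}$, $$\bigl|\{w\in P:\ \varphi_{N,w}(K)\le 4\delta\log N,\ \xi_{N,w}=1\}\bigr|\ \ge\ N^{1-\delta}$$ simultaneously for all paths $P$ in $V_N$ of diameter at least $N^{1-\kappa}$, where $\log$ is the natural logarithm. -/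

import Mathlib

open MeasureTheory ProbabilityTheory Filter
open scoped NNReal

noncomputable section

namespace CoarseMBRW

/-- The `N × N` box `V_N ⊆ ℤ²`, where `N = 2 ^ n`, with left bottom corner at the origin. -/
def V (n : ℕ) : Finset (ℤ × ℤ) :=
  Finset.Ico (0 : ℤ) (2 ^ n) ×ˢ Finset.Ico (0 : ℤ) (2 ^ n)

/-- The `ℓ_∞`-distance `|u - v|` on `ℤ²`. -/
def supDist (u v : ℤ × ℤ) : ℕ :=
  max (u.1 - v.1).natAbs (u.2 - v.2).natAbs

/-- The nearest-neighbour graph of `ℤ²`. -/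
def grid : SimpleGraph (ℤ × ℤ) where
  Adj u v := (u.1 - v.1).natAbs + (u.2 - v.2).natAbs = 1
  symm := ⟨fun u v h => by omega⟩
  loopless := ⟨fun u h => by simp at h⟩

/-- The set of vertices visited by a lattice path. -/
def vertices {u v : ℤ × ℤ} (P : grid.Walk u v) : Finset (ℤ × ℤ) :=
  P.support.toFinset

/-- The diameter of a lattice path: the maximal `ℓ_∞`-distance of two vertices on it. -/
def diam {u v : ℤ × ℤ} (P : grid.Walk u v) : ℕ :=
  (vertices P ×ˢ vertices P).sup fun e => supDist e.1 e.2

/-- The box of side length `2 ^ j` in `ℤ²` with lower left corner `c`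
(it has `2 ^ j` lattice points on each side). -/
def box (j : ℕ) (c : ℤ × ℤ) : Finset (ℤ × ℤ) :=
  Finset.Ico c.1 (c.1 + 2 ^ j) ×ˢ Finset.Ico c.2 (c.2 + 2 ^ j)

/-- The lower left corners of the boxes of side length `2 ^ j` that contain `z`;
see `mem_boxesAt`. -/
def boxesAt (j : ℕ) (z : ℤ × ℤ) : Finset (ℤ × ℤ) :=
  Finset.Ioc (z.1 - 2 ^ j) z.1 ×ˢ Finset.Ioc (z.2 - 2 ^ j) z.2

theorem mem_boxesAt {j : ℕ} {z c : ℤ × ℤ} : c ∈ boxesAt j z ↔ z ∈ box j c := by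
  simp only [boxesAt, box, Finset.mem_product, Finset.mem_Ioc, Finset.mem_Ico]
  generalize (2 : ℤ) ^ j = s
  omega

/-- `b` is a family of independent centered Gaussian variables `b_{j,B}`, indexed by the level
`j ≥ 0` and the box `B` of side length `2 ^ j` with corners in `ℤ²` (given by its lower left
corner), such that `Var b_{j,B} = 2 ^ (-2 j)`. -/
structure IsBoxNoise {Ω : Type*} [MeasurableSpace Ω] (μ : Measure Ω)
    (b : ℕ → ℤ × ℤ → Ω → ℝ) : Prop where
  measurable : ∀ j c, Measurable (b j c)
  law : ∀ j c, μ.map (b j c) = gaussianReal 0 ((2 : ℝ≥0) ^ (2 * j))⁻¹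
  indep : iIndepFun (fun i : ℕ × (ℤ × ℤ) => b i.1 i.2) μ

/-- The `K`-coarse modified branching random walk, `K = 2 ^ k`, `N = 2 ^ n`:
`φ_{N,z}(K) = ∑_{j=0}^{⌊n/k⌋-1} ∑_{B ∈ 𝓑_{jk}(z)} √k b_{jk,B}`. -/
def phi {Ω : Type*} (b : ℕ → ℤ × ℤ → Ω → ℝ) (n k : ℕ) (z : ℤ × ℤ) (ω : Ω) : ℝ :=
  ∑ j ∈ Finset.range (n / k), ∑ c ∈ boxesAt (j * k) z, Real.sqrt k * b (j * k) c ω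

/-- `{ξ_w : w ∈ V_N}` is a `q`-dependent Bernoulli field on `V_N`, `N = 2 ^ n`, all of whose
densities are at least `p`. Only the values of `ξ` on `V_N` matter. -/
structure IsBernoulliField {Ω : Type*} [MeasurableSpace Ω] (μ : Measure Ω)
    (n q : ℕ) (p : ℝ) (ξ : ℤ × ℤ → Ω → ℕ) : Prop where
  measurable : ∀ w ∈ V n, Measurable (ξ w)
  zero_or_one : ∀ w ∈ V n, ∀ ω, ξ w ω = 0 ∨ ξ w ω = 1
  dependent : ∀ A ⊆ V n, ∀ B ⊆ V n, (∀ z ∈ A, ∀ w ∈ B, q < supDist z w) →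
    IndepFun (fun ω (z : A) => ξ z ω) (fun ω (w : B) => ξ w ω) μ
  density : ∀ w ∈ V n, p ≤ μ.real {ω | ξ w ω = 1}

end CoarseMBRW

end

open CoarseMBRW

namespace CoarseMBRW

/-! A long path contains the leaves of a regular `d`-ary tree whose generations live at scales `A ^
i`, `A = 2 ^ a`, with siblings well separated (`exists_tree`). Since `d` is about `A / ρ` with `ρ =
q + 6` fixed, taking `a` large makes the number of leaves `d ^ h` at least `2 * N ^ (1 - δ)`. The
trees that can occur, recorded by their cells, number at most a constant to the power of the number
of leaves, for each root (`card_trees_le`). A union bound over all paths therefore costs only a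
constant factor per leaf.

Split the levels of the field at side `N ^ (1 - δ ^ 2 / 2)`. The levels above it have total variance
at most of order `δ ^ 2 * n / 2`, and chaining with a Chernoff bound keeps their sum below `2 * δ *
n` on all of `V n` (`measure_exists_le_levelSum_le`, `eventually_top_bound`). For a level `j` below
it, stop the tree at the first scale above `2 ^ (j * k)`. The suprema of that single level near
separated cells are independent, and each has exponential moment at most a constant times `exp (128
* k * θ ^ 2)` (`lintegral_prod_regionBound_le`). Asking for an average above `ε * k` gains a factor
`exp (-k * ε ^ 2 / 512)` per cell, while the entropy per cell does not depend on `k`: this is why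
`K` must be large. Hence on every tree the average over the leaves of the positive part of level `j`
is at most `ε * k`. Summing over the levels and applying Markov's inequality, at most a quarter of
the leaves have low-level sum above `4 * ε * n`.

The leaves are more than `q` apart, so for `p` near `1` the same union bound shows that fewer than a
quarter of them have `ξ = 0` (`measure_card_zeros_le`). At least half of the leaves survive both
restrictions (`half_le_card_filter`). -/

/-! ### Distances along lattice paths. -/

theorem supDist_comm (u v : ℤ × ℤ) : supDist u v = supDist v u := by
  unfold supDist; omega

theorem supDist_triangle (u v w : ℤ × ℤ) : supDist u w ≤ supDist u v + supDist v w := by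
  unfold supDist; omega

theorem supDist_self (u : ℤ × ℤ) : supDist u u = 0 := by
  simp [supDist]

/-- A walk visits every value between those of a `1`-Lipschitz function at its ends. -/
theorem exists_mem_support_eq (f : ℤ × ℤ → ℕ) (hf : ∀ x y, grid.Adj x y → f y ≤ f x + 1) :
    ∀ {u v : ℤ × ℤ} (P : grid.Walk u v) (r : ℕ), f u ≤ r → r ≤ f v →
      ∃ x ∈ P.support, f x = r := by
  intro u v P
  induction P with
  | nil => intro r h₁ h₂; exact ⟨_, by simp, le_antisymm h₁ h₂⟩
  | @cons u w v h P ih =>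
    intro r h₁ h₂
    rcases h₁.eq_or_lt with h₁ | h₁
    · exact ⟨u, by simp, h₁⟩
    · obtain ⟨x, hx, hr⟩ := ih r (by have := hf u w h; omega) h₂
      exact ⟨x, by simp [hx], hr⟩

/-- Going back along `P` from `z` to its start and then forward to `y` is a walk inside `P`, and the
distance from `z` changes by at most one per step. -/
theorem exists_mem_vertices_supDist_eq {u v : ℤ × ℤ} (P : grid.Walk u v) :
    ∀ z ∈ vertices P, ∀ y ∈ vertices P, ∀ r ≤ supDist z y, ∃ x ∈ vertices P, supDist z x = r := by
  intro z hz y hy r hr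
  simp only [vertices, List.mem_toFinset] at *
  obtain ⟨x, hx, hxr⟩ := exists_mem_support_eq (supDist z)
    (fun x y h => by
      have h : (x.1 - y.1).natAbs + (x.2 - y.2).natAbs = 1 := h
      unfold supDist; omega)
    ((P.takeUntil z hz).reverse.append (P.takeUntil y hy)) r (by simp [supDist_self]) hr
  refine ⟨x, ?_, hxr⟩
  rw [SimpleGraph.Walk.mem_support_append_iff, SimpleGraph.Walk.support_reverse,
    List.mem_reverse] at hx
  rcases hx with hx | hx
  · exact P.support_takeUntil_subset_support hz hx
  · exact P.support_takeUntil_subset_support hy hx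

/-! ### Cells, and the extraction and counting of trees. -/

/-- The index of the cell of side `s` that contains `z`. -/
def cell (s : ℤ) (z : ℤ × ℤ) : ℤ × ℤ := (z.1 / s, z.2 / s)

theorem le_abs_ediv_sub_ediv {s t x y : ℤ} (hs : 0 < s) (h : t * s ≤ |x - y|) :
    t ≤ |x / s - y / s| := by
  have hx := Int.emod_add_mul_ediv x s
  have hy := Int.emod_add_mul_ediv y s
  have h1 := Int.emod_nonneg x hs.ne'
  have h2 := Int.emod_nonneg y hs.ne'
  have h3 := Int.emod_lt_of_pos x hs
  have h4 := Int.emod_lt_of_pos y hs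
  generalize x / s = a at *
  generalize y / s = b at *
  by_contra! hlt
  rcases abs_cases (x - y) with h5 | h5 <;> rcases abs_lt.1 hlt with ⟨h6, h7⟩
  · nlinarith [mul_le_mul_of_nonneg_right (show a - b + 1 ≤ t by linarith) hs.le]
  · nlinarith [mul_le_mul_of_nonneg_right (show b - a + 1 ≤ t by linarith) hs.le]

theorem le_supDist_cell {s t : ℕ} (hs : 0 < s) {x y : ℤ × ℤ} (h : t * s ≤ supDist x y) :
    t ≤ supDist (cell s x) (cell s y) := by
  unfold supDist cell at *
  rcases le_max_iff.1 h with h | h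
  · refine le_max_of_le_left ?_
    zify at h ⊢
    exact le_abs_ediv_sub_ediv (by exact_mod_cast hs) h
  · refine le_max_of_le_right ?_
    zify at h ⊢
    exact le_abs_ediv_sub_ediv (by exact_mod_cast hs) h

/-- The cells of side `s` that can contain a point at distance at most `A * s` from a point of
the cell `c` of side `A * s`. -/
noncomputable def subcells (A : ℕ) (c : ℤ × ℤ) : Finset (ℤ × ℤ) :=
  Finset.Ico (A * c.1 - A : ℤ) (A * c.1 + 2 * A) ×ˢ Finset.Ico (A * c.2 - A : ℤ) (A * c.2 + 2 * A)

theorem card_subcells (A : ℕ) (c : ℤ × ℤ) : (subcells A c).card = 9 * A ^ 2 := by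
  have h : ∀ x : ℤ, (A * x + 2 * A - (A * x - A) : ℤ).toNat = 3 * A := by intro x; ring_nf; omega
  rw [subcells, Finset.card_product, Int.card_Ico, Int.card_Ico, h, h]
  ring

theorem ediv_mem_Ico {A s x y : ℤ} (hA : 0 < A) (hs : 0 < s) (h : |x - y| ≤ A * s) :
    y / s ∈ Finset.Ico (A * (x / (A * s)) - A) (A * (x / (A * s)) + 2 * A) := by
  have hx := Int.emod_add_mul_ediv x (A * s)
  have h1 := Int.emod_nonneg x (mul_pos hA hs).ne'
  have h3 := Int.emod_lt_of_pos x (mul_pos hA hs)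
  rw [abs_le] at h
  rw [Finset.mem_Ico, Int.le_ediv_iff_mul_le hs, Int.ediv_lt_iff_lt_mul hs]
  constructor <;> nlinarith

theorem cell_mem_subcells {A s : ℕ} (hA : 0 < A) (hs : 0 < s) {z y : ℤ × ℤ}
    (h : supDist z y ≤ A * s) : cell s y ∈ subcells A (cell (A * s : ℕ) z) := by
  have hA' : (0 : ℤ) < A := by exact_mod_cast hA
  have hs' : (0 : ℤ) < s := by exact_mod_cast hs
  obtain ⟨h1, h2⟩ := max_le_iff.1 h
  zify at h1 h2
  simp only [cell, subcells, Finset.mem_product, Nat.cast_mul]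
  exact ⟨ediv_mem_Ico hA' hs' h1, ediv_mem_Ico hA' hs' h2⟩

/-- The possible sets of cells that label the vertices at depth `h` of a `d`-ary tree with root
cell `c`, the sides of the cells being divided by `A` in each generation. -/
noncomputable def trees (A d : ℕ) : ℕ → ℤ × ℤ → Finset (Finset (ℤ × ℤ))
  | 0, c => {{c}}
  | h + 1, c => (Fintype.piFinset fun _ : Fin d => (subcells A c).biUnion (trees A d h)).image
      fun f => Finset.univ.biUnion f

/-- Each edge chooses one of `9 * A ^ 2` subcells, and for `d ≥ 2` the number of edges `d + ... + d
^ h` is at most `2 * (d ^ h - 1)`. The entropy is thus linear in the number of leaves. -/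
theorem card_trees_le {A d : ℕ} (hA : 0 < A) (hd : 2 ≤ d) (h : ℕ) (c : ℤ × ℤ) :
    (trees A d h c).card ≤ (9 * A ^ 2) ^ (2 * (d ^ h - 1)) := by
  have hM : 0 < 9 * A ^ 2 := by positivity
  induction h generalizing c with
  | zero => simp [trees]
  | succ h ih =>
    calc (trees A d (h + 1) c).card
        ≤ ((subcells A c).biUnion (trees A d h)).card ^ d := by
          refine Finset.card_image_le.trans ?_
          simp [Fintype.card_piFinset]
      _ ≤ (9 * A ^ 2 * (9 * A ^ 2) ^ (2 * (d ^ h - 1))) ^ d := by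
          gcongr
          rw [← card_subcells A c]
          refine Finset.card_biUnion_le_card_mul _ _ _ fun c' _ => ?_
          rw [card_subcells]
          exact ih c'
      _ = (9 * A ^ 2) ^ ((1 + 2 * (d ^ h - 1)) * d) := by
          rw [← pow_succ', ← pow_mul, add_comm]
      _ ≤ _ := by
          refine Nat.pow_le_pow_right hM ?_
          have h1 : 1 ≤ d ^ h := Nat.one_le_pow _ _ (by omega)
          obtain ⟨e, he⟩ := Nat.exists_eq_add_of_le h1
          have h2 : 1 ≤ d ^ (h + 1) := Nat.one_le_pow _ _ (by omega)
          rw [he, Nat.add_sub_cancel_left, pow_succ, he]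
          have : (1 + 2 * e) * d + 2 ≤ 2 * ((1 + e) * d) := by nlinarith
          omega

/-- Hierarchical extraction of a regular `d`-ary tree from a set with the intermediate value
property for the distances from each of its points: `D i` is the generation at scale `A ^ i`. -/
theorem exists_tree {A ρ d : ℕ} (hA : 0 < A) (hρ : 3 ≤ ρ) (hd : d * ρ ≤ A) {P : Set (ℤ × ℤ)}
    (hP : ∀ z ∈ P, ∀ y ∈ P, ∀ r ≤ supDist z y, ∃ x ∈ P, supDist z x = r) (h : ℕ) :
    ∀ z ∈ P, (∃ y ∈ P, A ^ h ≤ supDist z y) → ∃ D : ℕ → Finset (ℤ × ℤ), ∀ i ≤ h,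
      ↑(D i) ⊆ P ∧ (∀ x ∈ D i, supDist z x ≤ A ^ h) ∧ (D i).card = d ^ (h - i) ∧
      (∀ x ∈ D i, ∀ y ∈ D i, x ≠ y → (ρ - 2) * A ^ i ≤ supDist x y) ∧
      (D i).image (cell (A ^ i : ℕ)) ∈ trees A d (h - i) (cell (A ^ h : ℕ) z) ∧
      ∀ f F : ℤ × ℤ → ℝ, (∀ x y, supDist y x ≤ A ^ i → f x ≤ F y) →
        ∑ x ∈ D 0, f x ≤ d ^ i * ∑ y ∈ D i, F y := by
  induction h with
  | zero =>
    intro z hz _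
    refine ⟨fun _ => {z}, fun i hi => ?_⟩
    obtain rfl : i = 0 := by omega
    refine ⟨by simpa using hz, by simp [supDist_self], by simp, by simp, by simp [trees], ?_⟩
    intro f F hfF
    simpa using hfF z z (by simp [supDist_self])
  | succ h ih =>
    rintro z hz ⟨y, hy, hzy⟩
    have hAh : 0 < A ^ h := by positivity
    have hpow : A ^ (h + 1) = A * A ^ h := pow_succ' A h
    -- A margin `ρ * A ^ h` is left even beyond the last child. It keeps every subtree within `A ^
    -- (h + 1)` of `z`, and it keeps `y` far enough from each child for the induction hypothesis to
    -- apply there.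
    have hbd : ∀ t : Fin d, (t : ℕ) * ρ * A ^ h + ρ * A ^ h ≤ A ^ (h + 1) := by
      intro t
      rw [hpow, ← add_mul]
      refine Nat.mul_le_mul_right _ (le_trans ?_ hd)
      rw [← Nat.succ_mul]
      exact Nat.mul_le_mul_right _ t.2
    have hρA : A ^ h ≤ ρ * A ^ h := Nat.le_mul_of_pos_left _ (by omega)
    -- The children are points of `P` on concentric spheres around `z`, with radii spaced by `ρ * A
    -- ^ h`.
    have hc : ∀ t : Fin d, ∃ x ∈ P, supDist z x = t * ρ * A ^ h := fun t =>
      hP z hz y hy _ (by have := hbd t; omega)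
    choose c hcP hcz using hc
    have := fun t => ih (c t) (hcP t) ⟨y, hy, by
      have h1 := supDist_triangle z (c t) y
      have h2 := hbd t
      rw [hcz t] at h1
      omega⟩
    choose D hD using this
    have hzx : ∀ i ≤ h, ∀ t, ∀ x ∈ D t i, supDist z x ≤ A ^ (h + 1) := by
      intro i hi t x hx
      have h1 := (hD t i hi).2.1 x hx
      have h2 := supDist_triangle z (c t) x
      have h3 := hbd t
      rw [hcz t] at h2
      omega
    -- The radii of two children differ by at least `ρ * A ^ h`, and each subtree strays at most `A
    -- ^ h` from its root; hence `ρ - 2`.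
    have hsep : ∀ i ≤ h, ∀ t u, t ≠ u → ∀ x ∈ D t i, ∀ y ∈ D u i,
        (ρ - 2) * A ^ h ≤ supDist x y := by
      have key : ∀ i ≤ h, ∀ t u, t < u → ∀ x ∈ D t i, ∀ y ∈ D u i,
          (ρ - 2) * A ^ h ≤ supDist x y := by
        intro i hi t u htu x hx y hy
        have h1 := (hD t i hi).2.1 x hx
        have h2 := (hD u i hi).2.1 y hy
        have h3 := supDist_triangle z (c t) x
        have h4 := supDist_triangle z x y
        have h5 := supDist_triangle z y (c u)
        rw [supDist_comm y] at h5
        rw [hcz] at h3 h5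
        have h6 : (t + 1 : ℕ) * ρ * A ^ h ≤ u * ρ * A ^ h := by
          gcongr; exact_mod_cast htu
        rw [add_mul, add_mul, one_mul] at h6
        rw [Nat.sub_mul]
        omega
      intro i hi t u htu x hx y hy
      rcases lt_or_gt_of_ne htu with h1 | h1
      · exact key i hi t u h1 x hx y hy
      · rw [supDist_comm]; exact key i hi u t h1 y hy x hx
    have hdisj : ∀ i ≤ h, ((Finset.univ : Finset (Fin d)) : Set (Fin d)).PairwiseDisjoint
        (fun t => D t i) := by
      intro i hi t _ u _ htu
      refine Finset.disjoint_left.2 fun x hx hx' => ?_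
      have h1 := hsep i hi t u htu x hx x hx'
      rw [supDist_self] at h1
      have : 0 < (ρ - 2) * A ^ h := Nat.mul_pos (by omega) hAh
      omega
    have hcard : ∀ i ≤ h, (Finset.univ.biUnion fun t => D t i).card = d ^ (h + 1 - i) := by
      intro i hi
      rw [Finset.card_biUnion (fun t ht u hu htu => hdisj i hi ht hu htu),
        Finset.sum_congr rfl fun t _ => (hD t i hi).2.2.1]
      simp [Nat.sub_add_comm hi, pow_succ']
    refine ⟨fun i => if i = h + 1 then {z} else Finset.univ.biUnion fun t => D t i, fun i hi => ?_⟩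
    rcases hi.eq_or_lt with rfl | hi'
    · simp only [if_true, if_neg (show ¬ 0 = h + 1 by omega)]
      refine ⟨by simpa using hz, by simp [supDist_self], by simp, by simp, by simp [trees], ?_⟩
      intro f F hfF
      refine (Finset.sum_le_card_nsmul _ _ (F z) fun x hx => ?_).trans_eq ?_
      · obtain ⟨t, -, hx⟩ := Finset.mem_biUnion.1 hx
        exact hfF _ _ (hzx 0 (Nat.zero_le _) t x hx)
      · rw [hcard 0 (Nat.zero_le _)]
        simp
    · have hi : i ≤ h := by omega
      simp only [if_neg hi'.ne, if_neg (show ¬ 0 = h + 1 by omega)]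
      refine ⟨?_, ?_, hcard i hi, ?_, ?_, ?_⟩
      · intro x hx
        obtain ⟨t, -, hx⟩ := Finset.mem_biUnion.1 hx
        exact (hD t i hi).1 hx
      · intro x hx
        obtain ⟨t, -, hx⟩ := Finset.mem_biUnion.1 hx
        exact hzx i hi t x hx
      · intro x hx y hy hxy
        obtain ⟨t, -, hx⟩ := Finset.mem_biUnion.1 hx
        obtain ⟨u, -, hy⟩ := Finset.mem_biUnion.1 hy
        by_cases htu : t = u
        · subst htu
          exact (hD t i hi).2.2.2.1 x hx y hy hxy
        · refine le_trans ?_ (hsep i hi t u htu x hx y hy)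
          gcongr
      · rw [Nat.sub_add_comm hi, trees, Finset.mem_image]
        refine ⟨fun t => (D t i).image (cell (A ^ i : ℕ)), ?_, ?_⟩
        · refine Fintype.mem_piFinset.2 fun t => Finset.mem_biUnion.2 ⟨cell (A ^ h : ℕ) (c t), ?_,
            (hD t i hi).2.2.2.2.1⟩
          rw [hpow]
          refine cell_mem_subcells hA hAh ?_
          have := hbd t
          rw [hcz, ← hpow]
          omega
        · rw [Finset.biUnion_image]
      · intro f F hfF
        rw [Finset.sum_biUnion (hdisj 0 (Nat.zero_le _)), Finset.sum_biUnion (hdisj i hi),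
          Finset.mul_sum]
        exact Finset.sum_le_sum fun t _ => (hD t i hi).2.2.2.2.2 f F hfF

/-! ### Exponential moments of the field and of its increments. -/

section Gaussian

variable {Ω : Type*} [MeasurableSpace Ω] {μ : Measure Ω} {b : ℕ → ℤ × ℤ → Ω → ℝ}

theorem IsBoxNoise.lintegral_exp_sum [IsProbabilityMeasure μ] (hb : IsBoxNoise μ b) {k : ℕ}
    (hk : 1 ≤ k) (s : Finset (ℕ × (ℤ × ℤ))) (a : ℕ × (ℤ × ℤ) → ℝ) :
    ∫⁻ ω, ENNReal.ofReal (Real.exp (∑ i ∈ s, a i * b (i.1 * k) i.2 ω)) ∂μ =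
      ENNReal.ofReal (Real.exp (∑ i ∈ s, a i ^ 2 * ((2 : ℝ) ^ (2 * (i.1 * k)))⁻¹ / 2)) := by
  have hinj : Function.Injective fun i : ℕ × (ℤ × ℤ) => (i.1 * k, i.2) := by
    rintro ⟨i, c⟩ ⟨j, e⟩ h
    simp only [Prod.mk.injEq] at h ⊢
    exact ⟨Nat.eq_of_mul_eq_mul_right hk h.1, h.2⟩
  have hind : iIndepFun (fun (i : ℕ × (ℤ × ℤ)) ω => a i * b (i.1 * k) i.2 ω) μ :=
    (hb.indep.precomp hinj).comp (fun i x => a i * x) fun i => measurable_const_mul (a i)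
  have hmgf := hind.mgf_sum (t := 1) (fun i => (hb.measurable _ _).const_mul _) s
  have hone : ∀ i, mgf (fun ω => a i * b (i.1 * k) i.2 ω) μ 1 =
      Real.exp (a i ^ 2 * ((2 : ℝ) ^ (2 * (i.1 * k)))⁻¹ / 2) := by
    intro i
    rw [mgf_const_mul, mgf_gaussianReal (hb.law _ _)]
    push_cast
    congr 1
    ring
  simp_rw [hone] at hmgf
  rw [← Real.exp_sum] at hmgf
  simp only [mgf, one_mul, Finset.sum_apply] at hmgf
  rw [← hmgf, ofReal_integral_eq_lintegral_ofReal]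
  · refine Integrable.of_integral_ne_zero ?_
    rw [hmgf]
    exact (Real.exp_pos _).ne'
  · exact ae_of_all _ fun ω => (Real.exp_pos _).le

/-- The part of the coarse branching random walk that comes from the levels in `J`. -/
noncomputable def levelSum (b : ℕ → ℤ × ℤ → Ω → ℝ) (k : ℕ) (J : Finset ℕ) (ω : Ω)
    (z : ℤ × ℤ) : ℝ :=
  ∑ j ∈ J, ∑ c ∈ boxesAt (j * k) z, Real.sqrt k * b (j * k) c ω

theorem card_boxesAt (l : ℕ) (z : ℤ × ℤ) : (boxesAt l z).card = 2 ^ (2 * l) := by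
  have h : ∀ x : ℤ, (x - (x - 2 ^ l)).toNat = 2 ^ l := by
    intro x
    rw [sub_sub_cancel]
    exact_mod_cast Int.toNat_natCast (2 ^ l)
  rw [boxesAt, Finset.card_product, Int.card_Ioc, Int.card_Ioc, h, h]
  ring

theorem card_Ioc_sdiff_Ioc_le (s x y : ℤ) :
    (Finset.Ioc (x - s) x \ Finset.Ioc (y - s) y).card ≤ (x - y).natAbs := by
  have hsub : Finset.Ioc (x - s) x \ Finset.Ioc (y - s) y ⊆
      Finset.Ioc y x ∪ Finset.Ioc (x - s) (y - s) := by
    intro c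
    simp only [Finset.mem_sdiff, Finset.mem_union, Finset.mem_Ioc]
    omega
  refine (Finset.card_le_card hsub).trans ((Finset.card_union_le _ _).trans ?_)
  rw [Int.card_Ioc, Int.card_Ioc]
  omega

/-- The corners counted lie in two boundary strips of width at most `r` and length `2 ^ l`. -/
theorem card_boxesAt_sdiff_le {r : ℕ} {z w : ℤ × ℤ} (l : ℕ) (h : supDist z w ≤ r) :
    (boxesAt l z \ boxesAt l w).card ≤ 2 * r * 2 ^ l := by
  have hsub : boxesAt l z \ boxesAt l w ⊆
      ((Finset.Ioc (z.1 - 2 ^ l) z.1 \ Finset.Ioc (w.1 - 2 ^ l) w.1) ×ˢ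
        Finset.Ioc (z.2 - 2 ^ l) z.2) ∪
      (Finset.Ioc (z.1 - 2 ^ l) z.1 ×ˢ
        (Finset.Ioc (z.2 - 2 ^ l) z.2 \ Finset.Ioc (w.2 - 2 ^ l) w.2)) := by
    intro c
    simp only [boxesAt, Finset.mem_sdiff, Finset.mem_union, Finset.mem_product]
    tauto
  have hc : ∀ x : ℤ, (Finset.Ioc (x - 2 ^ l) x).card = 2 ^ l := by
    intro x
    rw [Int.card_Ioc, sub_sub_cancel]
    exact_mod_cast Int.toNat_natCast (2 ^ l)
  obtain ⟨h1, h2⟩ := max_le_iff.1 h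
  refine (Finset.card_le_card hsub).trans ((Finset.card_union_le _ _).trans ?_)
  rw [Finset.card_product, Finset.card_product, hc, hc]
  have h3 := Nat.mul_le_mul_right (2 ^ l) ((card_Ioc_sdiff_Ioc_le (2 ^ l) z.1 w.1).trans h1)
  have h4 := Nat.mul_le_mul_left (2 ^ l) ((card_Ioc_sdiff_Ioc_le (2 ^ l) z.2 w.2).trans h2)
  nlinarith

theorem IsBoxNoise.measurable_levelSum (hb : IsBoxNoise μ b) (k : ℕ) (J : Finset ℕ) (z : ℤ × ℤ) :
    Measurable fun ω => levelSum b k J ω z :=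
  Finset.measurable_sum _ fun _ _ => Finset.measurable_sum _ fun _ _ =>
    (hb.measurable _ _).const_mul _

/-- Each level has variance `k`: a point lies in `4 ^ (j * k)` boxes, each contributing `k * 4 ^
(-(j * k))`. -/
theorem IsBoxNoise.lintegral_exp_levelSum [IsProbabilityMeasure μ] (hb : IsBoxNoise μ b) {k : ℕ}
    (hk : 1 ≤ k) (J : Finset ℕ) (z : ℤ × ℤ) (θ : ℝ) :
    ∫⁻ ω, ENNReal.ofReal (Real.exp (θ * levelSum b k J ω z)) ∂μ =
      ENNReal.ofReal (Real.exp (θ ^ 2 * k * J.card / 2)) := by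
  set T := J.biUnion fun j => boxesAt (j * k) z
  have hT : ∀ j ∈ J, boxesAt (j * k) z ⊆ T := fun j hj =>
    Finset.subset_biUnion_of_mem (fun j => boxesAt (j * k) z) hj
  have key := hb.lintegral_exp_sum hk (J ×ˢ T)
    fun i => if i.2 ∈ boxesAt (i.1 * k) z then θ * Real.sqrt k else 0
  simp only [Finset.sum_product] at key
  convert key using 5 with ω
  · rw [levelSum, Finset.mul_sum]
    refine Finset.sum_congr rfl fun j hj => ?_
    simp only [ite_mul, zero_mul]
    rw [Finset.sum_ite_mem, Finset.inter_eq_right.2 (hT j hj), Finset.mul_sum]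
    exact Finset.sum_congr rfl fun c _ => by ring
  · have : ∀ j ∈ J, ∑ c ∈ T, (if c ∈ boxesAt (j * k) z then θ * Real.sqrt k else 0) ^ 2 *
        ((2 : ℝ) ^ (2 * (j * k)))⁻¹ / 2 = θ ^ 2 * k / 2 := by
      intro j hj
      simp only [ite_pow, ite_mul, ite_div, zero_mul, zero_div,
        ne_eq, OfNat.ofNat_ne_zero, not_false_eq_true, zero_pow]
      rw [Finset.sum_ite_mem, Finset.inter_eq_right.2 (hT j hj), Finset.sum_const, card_boxesAt,
        mul_pow, Real.sq_sqrt (Nat.cast_nonneg k), nsmul_eq_mul]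
      push_cast
      field_simp
    rw [Finset.sum_congr rfl this, Finset.sum_const, nsmul_eq_mul]
    ring

theorem sum_inv_two_pow_le {k j₀ : ℕ} (hk : 1 ≤ k) {J : Finset ℕ} (hJ : ∀ j ∈ J, j₀ ≤ j) :
    ∑ j ∈ J, ((2 : ℝ) ^ (j * k))⁻¹ ≤ 2 * ((2 : ℝ) ^ (j₀ * k))⁻¹ := by
  have hle : ∀ j ∈ J, ((2 : ℝ) ^ (j * k))⁻¹ ≤ ((2 : ℝ) ^ (j₀ * k))⁻¹ * (1 / 2) ^ (j - j₀) := by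
    intro j hj
    obtain ⟨i, rfl⟩ := Nat.exists_eq_add_of_le (hJ j hj)
    rw [add_mul, pow_add, mul_inv, Nat.add_sub_cancel_left, one_div, inv_pow]
    gcongr
    · norm_num
    · nlinarith
  have hinj : Set.InjOn (fun j => j - j₀) (J : Set ℕ) := by
    intro x hx y hy h
    have := hJ x hx
    have := hJ y hy
    simp only at h
    omega
  calc ∑ j ∈ J, ((2 : ℝ) ^ (j * k))⁻¹
      ≤ ∑ j ∈ J, ((2 : ℝ) ^ (j₀ * k))⁻¹ * (1 / 2) ^ (j - j₀) := Finset.sum_le_sum hle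
    _ = ((2 : ℝ) ^ (j₀ * k))⁻¹ * ∑ i ∈ J.image (fun j => j - j₀), (1 / 2 : ℝ) ^ i := by
        rw [← Finset.mul_sum, Finset.sum_image hinj]
    _ ≤ ((2 : ℝ) ^ (j₀ * k))⁻¹ * 2 := by
        gcongr
        exact (summable_geometric_two.sum_le_tsum _ fun _ _ => by positivity).trans_eq
          tsum_geometric_two
    _ = _ := mul_comm _ _

/-- Only boxes containing exactly one of `z`, `w` matter, so level `j` gives the increment variance
at most `4 * k * r * 2 ^ (-(j * k))`. The geometric sum over levels is at most twice the term of the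
lowest level `j₀`. -/
theorem IsBoxNoise.lintegral_exp_levelSum_sub_le [IsProbabilityMeasure μ] (hb : IsBoxNoise μ b)
    {k j₀ r : ℕ} (hk : 1 ≤ k) {J : Finset ℕ} (hJ : ∀ j ∈ J, j₀ ≤ j) {z w : ℤ × ℤ}
    (h : supDist z w ≤ r) (θ : ℝ) :
    ∫⁻ ω, ENNReal.ofReal (Real.exp (θ * (levelSum b k J ω z - levelSum b k J ω w))) ∂μ ≤
      ENNReal.ofReal (Real.exp (4 * θ ^ 2 * k * r * ((2 : ℝ) ^ (j₀ * k))⁻¹)) := by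
  set T := J.biUnion fun j => boxesAt (j * k) z ∪ boxesAt (j * k) w
  have hT : ∀ j ∈ J, boxesAt (j * k) z ∪ boxesAt (j * k) w ⊆ T := fun j hj =>
    Finset.subset_biUnion_of_mem (fun j => boxesAt (j * k) z ∪ boxesAt (j * k) w) hj
  have hTz : ∀ j ∈ J, boxesAt (j * k) z ⊆ T := fun j hj => Finset.subset_union_left.trans (hT j hj)
  have hTw : ∀ j ∈ J, boxesAt (j * k) w ⊆ T := fun j hj => Finset.subset_union_right.trans (hT j hj)
  have key := hb.lintegral_exp_sum hk (J ×ˢ T)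
    fun i => θ * Real.sqrt k * ((if i.2 ∈ boxesAt (i.1 * k) z then 1 else 0) -
      (if i.2 ∈ boxesAt (i.1 * k) w then 1 else 0))
  simp only [Finset.sum_product] at key
  have hlhs : ∀ ω, θ * (levelSum b k J ω z - levelSum b k J ω w) =
      ∑ j ∈ J, ∑ c ∈ T, θ * Real.sqrt k * ((if c ∈ boxesAt (j * k) z then 1 else 0) -
        (if c ∈ boxesAt (j * k) w then 1 else 0)) * b (j * k) c ω := by
    intro ω
    rw [levelSum, levelSum, ← Finset.sum_sub_distrib, Finset.mul_sum]
    refine Finset.sum_congr rfl fun j hj => ?_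
    have : ∀ c, θ * Real.sqrt k * ((if c ∈ boxesAt (j * k) z then 1 else 0) -
        (if c ∈ boxesAt (j * k) w then 1 else 0)) * b (j * k) c ω =
        θ * ((if c ∈ boxesAt (j * k) z then Real.sqrt k * b (j * k) c ω else 0) -
          if c ∈ boxesAt (j * k) w then Real.sqrt k * b (j * k) c ω else 0) := by
      intro c; split_ifs <;> ring
    simp only [this]
    rw [← Finset.mul_sum T, Finset.sum_sub_distrib, Finset.sum_ite_mem, Finset.sum_ite_mem,
      Finset.inter_eq_right.2 (hTz j hj), Finset.inter_eq_right.2 (hTw j hj)]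
  simp only [hlhs]
  rw [key]
  refine ENNReal.ofReal_le_ofReal (Real.exp_le_exp.2 ?_)
  have hone : ∀ j ∈ J, ∑ c ∈ T, (θ * Real.sqrt k * ((if c ∈ boxesAt (j * k) z then 1 else 0) -
      (if c ∈ boxesAt (j * k) w then 1 else 0))) ^ 2 * ((2 : ℝ) ^ (2 * (j * k)))⁻¹ / 2 ≤
      2 * θ ^ 2 * k * r * ((2 : ℝ) ^ (j * k))⁻¹ := by
    intro j hj
    have : ∀ c, (θ * Real.sqrt k * ((if c ∈ boxesAt (j * k) z then 1 else 0) -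
        (if c ∈ boxesAt (j * k) w then 1 else 0))) ^ 2 * ((2 : ℝ) ^ (2 * (j * k)))⁻¹ / 2 =
        θ ^ 2 * k * ((2 : ℝ) ^ (2 * (j * k)))⁻¹ / 2 *
          ((if c ∈ boxesAt (j * k) z \ boxesAt (j * k) w then 1 else 0) +
          (if c ∈ boxesAt (j * k) w \ boxesAt (j * k) z then 1 else 0)) := by
      intro c
      rw [mul_pow, mul_pow, Real.sq_sqrt (Nat.cast_nonneg k)]
      simp only [Finset.mem_sdiff]
      by_cases h1 : c ∈ boxesAt (j * k) z <;> by_cases h2 : c ∈ boxesAt (j * k) w <;>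
        simp [h1, h2]
    simp only [this]
    rw [← Finset.mul_sum, Finset.sum_add_distrib, Finset.sum_ite_mem, Finset.sum_ite_mem,
      Finset.inter_eq_right.2 (Finset.sdiff_subset.trans (hTz j hj)),
      Finset.inter_eq_right.2 (Finset.sdiff_subset.trans (hTw j hj))]
    simp only [Finset.sum_const, nsmul_eq_mul, mul_one]
    have h1 : ((boxesAt (j * k) z \ boxesAt (j * k) w).card : ℝ) ≤ 2 * r * 2 ^ (j * k) := by
      exact_mod_cast card_boxesAt_sdiff_le (j * k) h
    have h2 : ((boxesAt (j * k) w \ boxesAt (j * k) z).card : ℝ) ≤ 2 * r * 2 ^ (j * k) := by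
      exact_mod_cast card_boxesAt_sdiff_le (j * k) (by rwa [supDist_comm])
    calc _ ≤ θ ^ 2 * k * ((2 : ℝ) ^ (2 * (j * k)))⁻¹ / 2 *
          (2 * r * 2 ^ (j * k) + 2 * r * 2 ^ (j * k)) := by gcongr
      _ = _ := by
        rw [two_mul (j * k), pow_add]
        field_simp
        ring
  calc _ ≤ ∑ j ∈ J, 2 * θ ^ 2 * k * r * ((2 : ℝ) ^ (j * k))⁻¹ := Finset.sum_le_sum hone
    _ = 2 * θ ^ 2 * k * r * ∑ j ∈ J, ((2 : ℝ) ^ (j * k))⁻¹ := by rw [Finset.mul_sum]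
    _ ≤ 2 * θ ^ 2 * k * r * (2 * ((2 : ℝ) ^ (j₀ * k))⁻¹) := by
      gcongr
      exact sum_inv_two_pow_le hk hJ
    _ = _ := by ring

end Gaussian

/-! ### Chaining: pathwise bounds for the exponential of a supremum over a box. -/

/-- The weights of the chaining argument. -/
noncomputable def chainWeight (i : ℕ) : ℝ := (1 / 4) * (3 / 4) ^ i

theorem chainWeight_pos (i : ℕ) : 0 < chainWeight i := by unfold chainWeight; positivity

theorem sum_chainWeight (l : ℕ) :
    ∑ i ∈ Finset.range l, chainWeight i = 1 - (3 / 4) ^ l := by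
  induction l with
  | zero => simp
  | succ l ih => rw [Finset.sum_range_succ, ih, chainWeight, pow_succ]; ring

theorem sum_mul_chainWeight (l : ℕ) :
    ∑ i ∈ Finset.range l, chainWeight i * (i + 1) = 4 - (l + 4) * (3 / 4) ^ l := by
  induction l with
  | zero => simp
  | succ l ih => rw [Finset.sum_range_succ, ih, chainWeight, pow_succ]; push_cast; ring

/-- The point with index `t` in the grid of mesh `s` with origin `z`. -/
def gridPt (z : ℤ × ℤ) (s : ℕ) (t : ℤ × ℤ) : ℤ × ℤ := (z.1 + s * t.1, z.2 + s * t.2)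

/-- The index set of a square grid with `s` points on each side. -/
noncomputable def square (s : ℕ) : Finset (ℤ × ℤ) := Finset.Ico (0 : ℤ) s ×ˢ Finset.Ico (0 : ℤ) s

theorem card_square (s : ℕ) : (square s).card = s ^ 2 := by
  simp [square, sq]

/-- The increment of `Y` between a point of the grid of mesh `2 ^ (l - (i + 1))` and its
predecessor in the grid of mesh `2 ^ (l - i)`. -/
noncomputable def chainStep (l : ℕ) (Y : ℤ × ℤ → ℝ) (z : ℤ × ℤ) (i : ℕ) (t : ℤ × ℤ) : ℝ :=
  Y (gridPt z (2 ^ (l - (i + 1))) t) - Y (gridPt z (2 ^ (l - i)) (cell 2 t))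

/-- An upper bound, by chaining, for `exp (θ * (Y y - Y z))` uniformly in `y ∈ box l z`. -/
noncomputable def chainBound (θ : ℝ) (l : ℕ) (Y : ℤ × ℤ → ℝ) (z : ℤ × ℤ) : ℝ :=
  4096 * (1 + ∑ i ∈ Finset.range l, ∑ t ∈ square (2 ^ (i + 1)),
    chainWeight i * (1 / 8) ^ (i + 1) * Real.exp (θ / chainWeight i * chainStep l Y z i t))

/-- Jensen's inequality, with the missing mass `(3 / 4) ^ l` of the weights placed at `0`. -/
theorem exp_sum_le {l : ℕ} (x : ℕ → ℝ) :
    Real.exp (∑ i ∈ Finset.range l, chainWeight i * x i) ≤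
      1 + ∑ i ∈ Finset.range l, chainWeight i * Real.exp (x i) := by
  have h := convexOn_exp.map_add_sum_le (t := Finset.range l) (w := chainWeight) (p := x)
    (v := (3 / 4) ^ l) (q := 0) (fun i _ => (chainWeight_pos i).le)
    (by rw [sum_chainWeight]; ring) (fun _ _ => Set.mem_univ _) (by positivity) (Set.mem_univ _)
  simp only [smul_eq_mul, mul_zero, zero_add, Real.exp_zero, mul_one] at h
  have : (3 / 4 : ℝ) ^ l ≤ 1 := pow_le_one₀ (by norm_num) (by norm_num)
  linarith

theorem exp_le_chainBound (θ : ℝ) {l : ℕ} (Y : ℤ × ℤ → ℝ) {z y : ℤ × ℤ} (hy : y ∈ box l z) :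
    Real.exp (θ * (Y y - Y z)) ≤ chainBound θ l Y z := by
  simp only [box, Finset.mem_product, Finset.mem_Ico] at hy
  set u : ℤ × ℤ := (y.1 - z.1, y.2 - z.2) with hu
  -- The dyadic ancestors of `y` relative to `z`: `t 0` is the corner `z` and `t l` is `y` itself.
  set t : ℕ → ℤ × ℤ := fun i => cell ((2 : ℤ) ^ (l - i)) u with ht
  have htmem : ∀ i < l, t (i + 1) ∈ square (2 ^ (i + 1)) := by
    have hone : ∀ i < l, ∀ a : ℤ, 0 ≤ a → a < 2 ^ l →
        a / 2 ^ (l - (i + 1)) ∈ Finset.Ico (0 : ℤ) ((2 ^ (i + 1) : ℕ) : ℤ) := by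
      intro i hi a h0 h1
      rw [Finset.mem_Ico, Int.ediv_lt_iff_lt_mul (by positivity)]
      refine ⟨Int.ediv_nonneg h0 (by positivity), ?_⟩
      push_cast
      rw [← pow_add, show i + 1 + (l - (i + 1)) = l by omega]
      exact h1
    intro i hi
    exact Finset.mem_product.2 ⟨hone i hi _ (by simp only [hu]; omega) (by simp only [hu]; omega),
      hone i hi _ (by simp only [hu]; omega) (by simp only [hu]; omega)⟩
  have hcell : ∀ i < l, cell 2 (t (i + 1)) = t i := by
    intro i hi
    have h2 : (2 : ℤ) ^ (l - i) = 2 ^ (l - (i + 1)) * 2 := by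
      rw [← pow_succ]; congr 1; omega
    simp only [ht, cell, h2]
    rw [Int.ediv_ediv_of_nonneg (by positivity), Int.ediv_ediv_of_nonneg (by positivity)]
  have htop : gridPt z (2 ^ (l - l)) (t l) = y := by
    simp [gridPt, ht, cell, hu]
  have hbot : gridPt z (2 ^ (l - 0)) (t 0) = z := by
    simp only [gridPt, ht, cell, hu, Nat.sub_zero]
    rw [Int.ediv_eq_zero_of_lt (by omega) (by omega), Int.ediv_eq_zero_of_lt (by omega) (by omega)]
    simp
  have htel : Y y - Y z = ∑ i ∈ Finset.range l, chainStep l Y z i (t (i + 1)) := by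
    have h := Finset.sum_range_sub (fun i => Y (gridPt z (2 ^ (l - i)) (t i))) l
    simp only [htop, hbot] at h
    rw [← h]
    refine Finset.sum_congr rfl fun i hi => ?_
    rw [chainStep, hcell i (Finset.mem_range.1 hi)]
  -- Subtracting `(i + 1) * log 8` in generation `i` creates the factor `(1 / 8) ^ (i + 1)`, which
  -- outweighs the `4 ^ (i + 1)` grid points. The weighted penalties add up to at most `4 * log 8`,
  -- hence the prefactor `4096 = 8 ^ 4`.
  have hlog : Real.log 8 * ∑ i ∈ Finset.range l, chainWeight i * (i + 1) ≤ Real.log 4096 := by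
    rw [sum_mul_chainWeight, show (4096 : ℝ) = 8 ^ 4 by norm_num, Real.log_pow]
    have h1 : 0 < Real.log 8 := Real.log_pos (by norm_num)
    have h2 : 0 ≤ ((l : ℝ) + 4) * (3 / 4) ^ l := by positivity
    push_cast
    nlinarith
  have hexp : ∀ i, Real.exp (-((i + 1 : ℕ) * Real.log 8)) = (1 / 8 : ℝ) ^ (i + 1) := by
    intro i
    rw [Real.exp_neg, Real.exp_nat_mul, Real.exp_log (by norm_num), one_div, inv_pow]
  have hsplit : θ * (Y y - Y z) = (∑ i ∈ Finset.range l, chainWeight i *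
      (θ / chainWeight i * chainStep l Y z i (t (i + 1)) - (i + 1 : ℕ) * Real.log 8)) +
      Real.log 8 * ∑ i ∈ Finset.range l, chainWeight i * (i + 1) := by
    rw [htel, Finset.mul_sum, Finset.mul_sum, ← Finset.sum_add_distrib]
    refine Finset.sum_congr rfl fun i _ => ?_
    have := (chainWeight_pos i).ne'
    field_simp
    push_cast
    ring
  rw [hsplit, Real.exp_add, mul_comm, chainBound]
  refine mul_le_mul ?_ ?_ (Real.exp_pos _).le (by norm_num)
  · rw [← Real.le_log_iff_exp_le (by norm_num)]
    exact hlog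
  · refine (exp_sum_le _).trans (add_le_add_right (Finset.sum_le_sum fun i hi => ?_) _)
    rw [sub_eq_add_neg, Real.exp_add, hexp]
    refine le_trans (le_of_eq ?_) (Finset.single_le_sum
      (f := fun t => chainWeight i * (1 / 8) ^ (i + 1) *
        Real.exp (θ / chainWeight i * chainStep l Y z i t)) (fun t _ => ?_)
      (htmem i (Finset.mem_range.1 hi)))
    · ring
    · have := chainWeight_pos i
      positivity

/-- An upper bound for `exp (θ * Y y)` uniformly in `y ∈ box l z`. -/
noncomputable def boxBound (θ : ℝ) (l : ℕ) (Y : ℤ × ℤ → ℝ) (z : ℤ × ℤ) : ℝ :=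
  1 / 2 * Real.exp (2 * θ * Y z) + 1 / 2 * chainBound (2 * θ) l Y z

/-- Convexity separates the value at the corner from the increment: `θ` doubles, but no joint moment
is needed. -/
theorem exp_le_boxBound (θ : ℝ) {l : ℕ} (Y : ℤ × ℤ → ℝ) {z y : ℤ × ℤ} (hy : y ∈ box l z) :
    Real.exp (θ * Y y) ≤ boxBound θ l Y z := by
  have h := convexOn_exp.2 (Set.mem_univ (2 * θ * Y z)) (Set.mem_univ (2 * θ * (Y y - Y z)))
    (show (0 : ℝ) ≤ 1 / 2 by norm_num) (show (0 : ℝ) ≤ 1 / 2 by norm_num) (by norm_num)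
  simp only [smul_eq_mul] at h
  have h2 := exp_le_chainBound (2 * θ) Y hy
  have h3 : θ * Y y = 1 / 2 * (2 * θ * Y z) + 1 / 2 * (2 * θ * (Y y - Y z)) := by ring
  rw [h3, boxBound]
  linarith

theorem boxBound_nonneg (θ : ℝ) (l : ℕ) (Y : ℤ × ℤ → ℝ) (z : ℤ × ℤ) : 0 ≤ boxBound θ l Y z := by
  have : ∀ i, 0 ≤ chainWeight i := fun i => (chainWeight_pos i).le
  unfold boxBound chainBound
  have : 0 ≤ ∑ i ∈ Finset.range l, ∑ t ∈ square (2 ^ (i + 1)),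
    chainWeight i * (1 / 8) ^ (i + 1) *
      Real.exp (2 * θ / chainWeight i * chainStep l Y z i t) :=
    Finset.sum_nonneg fun i _ => Finset.sum_nonneg fun t _ => by have := this i; positivity
  positivity

theorem supDist_gridPt_le (z : ℤ × ℤ) (s : ℕ) (t : ℤ × ℤ) :
    supDist (gridPt z s t) (gridPt z (s * 2) (cell 2 t)) ≤ s := by
  have key : ∀ a x : ℤ, (a + s * x - (a + (s * 2 : ℕ) * (x / 2))).natAbs ≤ s := by
    intro a x
    have h1 : a + s * x - (a + (s * 2 : ℕ) * (x / 2)) = s * (x % 2) := by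
      rw [Int.emod_def]; push_cast; ring
    rw [h1, Int.natAbs_mul, Int.natAbs_natCast]
    exact (Nat.mul_le_mul_left s (show (x % 2).natAbs ≤ 1 by omega)).trans_eq (mul_one s)
  exact max_le (key _ _) (key _ _)

/-- All chaining points lie in the box. The σ-algebra `m` is left free so that it can be the one
generated by the nearby noise, which is what independence requires. -/
theorem measurable_boxBound_levelSum {Ω : Type*} {m : MeasurableSpace Ω} {b : ℕ → ℤ × ℤ → Ω → ℝ} {k : ℕ}
    {J : Finset ℕ} {l : ℕ} {z : ℤ × ℤ} (θ : ℝ)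
    (h : ∀ y ∈ box l z, Measurable[m] fun ω => levelSum b k J ω y) :
    Measurable[m] fun ω => boxBound θ l (levelSum b k J ω) z := by
  have hpt : ∀ s r : ℕ, s * r ≤ 2 ^ l → ∀ t ∈ square r, gridPt z s t ∈ box l z := by
    intro s r hsr t ht
    simp only [square, Finset.mem_product, Finset.mem_Ico] at ht
    zify at hsr
    have key : ∀ x : ℤ, 0 ≤ x → x < r → 0 < 2 ^ l → 0 ≤ s * x ∧ s * x < 2 ^ l := by
      intro x h0 h1 h2
      refine ⟨by positivity, ?_⟩
      rcases Nat.eq_zero_or_pos s with rfl | hs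
      · simp
      · have : (s : ℤ) * x < s * r := by
          have : (0 : ℤ) < s := by exact_mod_cast hs
          nlinarith
        linarith
    have h1 := key _ ht.1.1 ht.1.2 (by positivity)
    have h2 := key _ ht.2.1 ht.2.2 (by positivity)
    simp only [box, gridPt, Finset.mem_product, Finset.mem_Ico]
    refine ⟨⟨?_, ?_⟩, ?_, ?_⟩ <;> linarith [h1.1, h1.2, h2.1, h2.2]
  have hz : z ∈ box l z := by simp [box]
  unfold boxBound chainBound
  refine Measurable.add ?_ ?_
  · exact ((h z hz).const_mul _).exp.const_mul _
  · refine ((Finset.measurable_sum _ fun i hi => Finset.measurable_sum _ fun t ht => ?_).const_add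
      _).const_mul _ |>.const_mul _
    have hi := Finset.mem_range.1 hi
    refine (Measurable.exp (Measurable.const_mul (Measurable.sub (h _ ?_) (h _ ?_)) _)).const_mul _
    · refine hpt _ (2 ^ (i + 1)) ?_ t ht
      rw [← pow_add, Nat.sub_add_cancel (by omega)]
    · refine hpt _ (2 ^ i) ?_ _ ?_
      · rw [← pow_add, Nat.sub_add_cancel (by omega)]
      · simp only [square, cell, Finset.mem_product, Finset.mem_Ico] at ht ⊢
        push_cast [pow_succ] at ht ⊢
        omega

/-! ### Expectation of the chaining bound. -/

section Expectation

variable {Ω : Type*} [MeasurableSpace Ω] {μ : Measure Ω} {b : ℕ → ℤ × ℤ → Ω → ℝ}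

theorem IsBoxNoise.lintegral_boxBound_le [IsProbabilityMeasure μ] (hb : IsBoxNoise μ b)
    {k j₀ : ℕ} (hk : 1 ≤ k) {J : Finset ℕ} (hJ : ∀ j ∈ J, j₀ ≤ j) (z : ℤ × ℤ) (θ : ℝ) :
    ∫⁻ ω, ENNReal.ofReal (boxBound θ (j₀ * k) (levelSum b k J ω) z) ∂μ ≤
      ENNReal.ofReal (1 / 2 * Real.exp (2 * θ ^ 2 * k * J.card) +
        2048 * (1 + Real.exp (128 * k * θ ^ 2))) := by
  set l := j₀ * k with hl
  have hmeas : ∀ y, Measurable fun ω => levelSum b k J ω y := hb.measurable_levelSum k J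
  have hexp : ∀ i < l, ∀ t, ∫⁻ ω, ENNReal.ofReal (Real.exp (2 * θ / chainWeight i *
      chainStep l (levelSum b k J ω) z i t)) ∂μ ≤
      ENNReal.ofReal (Real.exp (128 * k * θ ^ 2)) := by
    intro i hi t
    have h2 : 2 ^ (l - i) = 2 ^ (l - (i + 1)) * 2 := by
      rw [← pow_succ]; congr 1; omega
    refine (hb.lintegral_exp_levelSum_sub_le hk hJ (r := 2 ^ (l - (i + 1))) ?_ _).trans ?_
    · rw [h2]
      exact supDist_gridPt_le _ _ _
    · refine ENNReal.ofReal_le_ofReal (Real.exp_le_exp.2 ?_)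
      have h3 : ((2 ^ (l - (i + 1)) : ℕ) : ℝ) * ((2 : ℝ) ^ (j₀ * k))⁻¹ = (1 / 2) ^ (i + 1) := by
        rw [← hl, one_div, inv_pow]
        have : (2 : ℝ) ^ l = 2 ^ (l - (i + 1)) * 2 ^ (i + 1) := by
          rw [← pow_add, Nat.sub_add_cancel (by omega)]
        rw [this]
        push_cast
        field_simp
      -- The ratio `3 / 4` makes the squared weights decay more slowly than the increment variances,
      -- as `1 / 2 ≤ 9 / 16`. The moments are then uniform in `i`, with constant `4 * 2 ^ 2 * 16 / 2
      -- = 128`.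
      have h4 : (9 / 16 : ℝ) ^ i = chainWeight i ^ 2 * 16 := by
        rw [chainWeight, mul_pow, ← pow_mul, mul_comm i 2, pow_mul]; norm_num; ring
      have h5 : (1 / 2 : ℝ) ^ i ≤ (9 / 16) ^ i :=
        pow_le_pow_left₀ (by norm_num) (by norm_num) i
      have hq := chainWeight_pos i
      calc 4 * (2 * θ / chainWeight i) ^ 2 * k * ((2 ^ (l - (i + 1)) : ℕ) : ℝ) *
            ((2 : ℝ) ^ (j₀ * k))⁻¹
          = 4 * (2 * θ / chainWeight i) ^ 2 * k * (1 / 2) ^ (i + 1) := by rw [← h3]; ring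
        _ ≤ 4 * (2 * θ / chainWeight i) ^ 2 * k * (chainWeight i ^ 2 * 16 * (1 / 2)) := by
            rw [pow_succ (1 / 2 : ℝ), ← h4]
            gcongr
        _ = _ := by field_simp; ring
  have hsum : ∫⁻ ω, ENNReal.ofReal (∑ i ∈ Finset.range l, ∑ t ∈ square (2 ^ (i + 1)),
      chainWeight i * (1 / 8) ^ (i + 1) * Real.exp (2 * θ / chainWeight i *
        chainStep l (levelSum b k J ω) z i t)) ∂μ ≤
      ENNReal.ofReal (Real.exp (128 * k * θ ^ 2)) := by
    have hq : ∀ i, 0 ≤ chainWeight i := fun i => (chainWeight_pos i).le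
    have hms : ∀ i t, Measurable fun ω => ENNReal.ofReal (Real.exp (2 * θ / chainWeight i *
        chainStep l (levelSum b k J ω) z i t)) := fun i t =>
      ((((hmeas _).sub (hmeas _)).const_mul _).exp).ennreal_ofReal
    calc _ = ∫⁻ ω, ∑ i ∈ Finset.range l, ∑ t ∈ square (2 ^ (i + 1)),
          ENNReal.ofReal (chainWeight i * (1 / 8) ^ (i + 1)) *
            ENNReal.ofReal (Real.exp (2 * θ / chainWeight i *
              chainStep l (levelSum b k J ω) z i t)) ∂μ := by
          refine lintegral_congr fun ω => ?_
          rw [ENNReal.ofReal_sum_of_nonneg fun i _ => Finset.sum_nonneg fun t _ => by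
            have := hq i; positivity]
          refine Finset.sum_congr rfl fun i _ => ?_
          rw [ENNReal.ofReal_sum_of_nonneg fun t _ => by have := hq i; positivity]
          refine Finset.sum_congr rfl fun t _ => ?_
          rw [ENNReal.ofReal_mul (by have := hq i; positivity)]
      _ = ∑ i ∈ Finset.range l, ∑ t ∈ square (2 ^ (i + 1)),
          ENNReal.ofReal (chainWeight i * (1 / 8) ^ (i + 1)) *
            ∫⁻ ω, ENNReal.ofReal (Real.exp (2 * θ / chainWeight i *
              chainStep l (levelSum b k J ω) z i t)) ∂μ := by
          rw [lintegral_finsetSum _ fun i _ => Finset.measurable_sum _ fun t _ =>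
            (hms i t).const_mul _]
          refine Finset.sum_congr rfl fun i _ => ?_
          rw [lintegral_finsetSum _ fun t _ => (hms i t).const_mul _]
          exact Finset.sum_congr rfl fun t _ => lintegral_const_mul _ (hms i t)
      _ ≤ ∑ i ∈ Finset.range l, ∑ _t ∈ square (2 ^ (i + 1)),
          ENNReal.ofReal (chainWeight i * (1 / 8) ^ (i + 1)) *
            ENNReal.ofReal (Real.exp (128 * k * θ ^ 2)) := by
          refine Finset.sum_le_sum fun i hi => Finset.sum_le_sum fun t _ => ?_
          gcongr
          exact hexp i (Finset.mem_range.1 hi) t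
      _ ≤ ∑ i ∈ Finset.range l, ENNReal.ofReal (chainWeight i) *
            ENNReal.ofReal (Real.exp (128 * k * θ ^ 2)) := by
          refine Finset.sum_le_sum fun i _ => ?_
          rw [Finset.sum_const, card_square, nsmul_eq_mul, ← mul_assoc,
            ← ENNReal.ofReal_natCast, ← ENNReal.ofReal_mul (Nat.cast_nonneg _)]
          gcongr
          have h1 : ((((2 ^ (i + 1)) ^ 2 : ℕ) : ℝ)) * (1 / 8) ^ (i + 1) = (1 / 2) ^ (i + 1) := by
            push_cast
            rw [← pow_mul, mul_comm (i + 1) 2, pow_mul, ← mul_pow]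
            norm_num
          have h2 : (1 / 2 : ℝ) ^ (i + 1) ≤ 1 := pow_le_one₀ (by norm_num) (by norm_num)
          calc _ = chainWeight i * (1 / 2) ^ (i + 1) := by rw [← h1]; ring
            _ ≤ _ := mul_le_of_le_one_right (hq i) h2
      _ = ENNReal.ofReal (1 - (3 / 4) ^ l) * ENNReal.ofReal (Real.exp (128 * k * θ ^ 2)) := by
          rw [← Finset.sum_mul, ← ENNReal.ofReal_sum_of_nonneg fun i _ => hq i, sum_chainWeight]
      _ ≤ 1 * ENNReal.ofReal (Real.exp (128 * k * θ ^ 2)) := by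
          gcongr
          rw [ENNReal.ofReal_le_one]
          have : (0 : ℝ) ≤ (3 / 4) ^ l := by positivity
          linarith
      _ = _ := one_mul _
  have hSm : Measurable fun ω => ∑ i ∈ Finset.range l, ∑ t ∈ square (2 ^ (i + 1)),
      chainWeight i * (1 / 8) ^ (i + 1) * Real.exp (2 * θ / chainWeight i *
        chainStep l (levelSum b k J ω) z i t) :=
    Finset.measurable_sum _ fun i _ => Finset.measurable_sum _ fun t _ =>
      ((((hmeas _).sub (hmeas _)).const_mul _).exp).const_mul _
  have hSnn : ∀ ω, 0 ≤ ∑ i ∈ Finset.range l, ∑ t ∈ square (2 ^ (i + 1)),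
      chainWeight i * (1 / 8) ^ (i + 1) * Real.exp (2 * θ / chainWeight i *
        chainStep l (levelSum b k J ω) z i t) := fun ω =>
    Finset.sum_nonneg fun i _ => Finset.sum_nonneg fun t _ => by
      have := chainWeight_pos i; positivity
  unfold boxBound chainBound
  generalize hS : (fun ω => ∑ i ∈ Finset.range l, ∑ t ∈ square (2 ^ (i + 1)),
      chainWeight i * (1 / 8) ^ (i + 1) * Real.exp (2 * θ / chainWeight i *
        chainStep l (levelSum b k J ω) z i t)) = S at *
  have hSω : ∀ ω, ∑ i ∈ Finset.range l, ∑ t ∈ square (2 ^ (i + 1)),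
      chainWeight i * (1 / 8) ^ (i + 1) * Real.exp (2 * θ / chainWeight i *
        chainStep l (levelSum b k J ω) z i t) = S ω := fun ω => congrFun hS ω
  simp only [hSω] at *
  have hG := hb.lintegral_exp_levelSum hk J z (2 * θ)
  have hGm : Measurable fun ω => Real.exp (2 * θ * levelSum b k J ω z) :=
    ((hmeas z).const_mul _).exp
  calc ∫⁻ ω, ENNReal.ofReal (1 / 2 * Real.exp (2 * θ * levelSum b k J ω z) +
        1 / 2 * (4096 * (1 + S ω))) ∂μ
      = ∫⁻ ω, (ENNReal.ofReal (1 / 2) * ENNReal.ofReal (Real.exp (2 * θ * levelSum b k J ω z)) +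
        ENNReal.ofReal 2048 * (1 + ENNReal.ofReal (S ω))) ∂μ := by
        refine lintegral_congr fun ω => ?_
        have := hSnn ω
        rw [ENNReal.ofReal_add (by positivity) (by positivity),
          ENNReal.ofReal_mul (by norm_num), ← mul_assoc, ENNReal.ofReal_mul (by norm_num),
          ENNReal.ofReal_add (by norm_num) this, ENNReal.ofReal_one]
        norm_num
    _ = ENNReal.ofReal (1 / 2) * ENNReal.ofReal (Real.exp ((2 * θ) ^ 2 * k * J.card / 2)) +
        ENNReal.ofReal 2048 * (1 + ∫⁻ ω, ENNReal.ofReal (S ω) ∂μ) := by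
        rw [lintegral_add_left (hGm.ennreal_ofReal.const_mul _),
          lintegral_const_mul _ hGm.ennreal_ofReal, hG,
          lintegral_const_mul _ (hSm.ennreal_ofReal.const_add _),
          lintegral_add_left measurable_const]
        simp
    _ ≤ ENNReal.ofReal (1 / 2) * ENNReal.ofReal (Real.exp ((2 * θ) ^ 2 * k * J.card / 2)) +
        ENNReal.ofReal 2048 * (1 + ENNReal.ofReal (Real.exp (128 * k * θ ^ 2))) := by
        gcongr
    _ = _ := by
        rw [← ENNReal.ofReal_one, ← ENNReal.ofReal_add (by norm_num) (Real.exp_pos _).le,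
          ← ENNReal.ofReal_mul (by norm_num), ← ENNReal.ofReal_mul (by norm_num),
          ← ENNReal.ofReal_add (by positivity) (by positivity)]
        congr 4
        ring

end Expectation

/-! ### Suprema near a cell. -/

/-- An upper bound for `exp (θ * max (Y x) 0)` uniformly over the points `x` at distance at most
`s = r * 2 ^ l` from the cell `c` of side `s`. -/
noncomputable def regionBound (θ : ℝ) (l r : ℕ) (Y : ℤ × ℤ → ℝ) (c : ℤ × ℤ) : ℝ :=
  1 + ∑ t ∈ square (3 * r),
    boxBound θ l Y (gridPt ((c.1 - 1) * (r * 2 ^ l), (c.2 - 1) * (r * 2 ^ l)) (2 ^ l) t)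

theorem regionBound_pos (θ : ℝ) (l r : ℕ) (Y : ℤ × ℤ → ℝ) (c : ℤ × ℤ) :
    0 < regionBound θ l r Y c :=
  add_pos_of_pos_of_nonneg one_pos (Finset.sum_nonneg fun _ _ => boxBound_nonneg _ _ _ _)

/-- The `3 × 3` block of cells around `c` is tiled by `(3 * r) ^ 2` boxes of side `2 ^ l`, one of
which contains `x`. The summand `1` covers the case `Y x ≤ 0`. -/
theorem exp_le_regionBound {θ : ℝ} {l r : ℕ} (hr : 0 < r) (Y : ℤ × ℤ → ℝ)
    {x y : ℤ × ℤ} (h : supDist y x ≤ r * 2 ^ l) :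
    Real.exp (θ * max (Y x) 0) ≤ regionBound θ l r Y (cell (r * 2 ^ l : ℕ) y) := by
  set c := cell (r * 2 ^ l : ℕ) y with hc
  set w : ℤ × ℤ := ((c.1 - 1) * (r * 2 ^ l), (c.2 - 1) * (r * 2 ^ l)) with hw
  have hnn : 0 ≤ ∑ t ∈ square (3 * r), boxBound θ l Y (gridPt w (2 ^ l) t) :=
    Finset.sum_nonneg fun _ _ => boxBound_nonneg _ _ _ _
  rcases le_total (Y x) 0 with hY | hY
  · rw [max_eq_right hY, mul_zero, Real.exp_zero, regionBound]
    linarith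
  · rw [max_eq_left hY]
    have key : ∀ a e : ℤ, (a - e).natAbs ≤ r * 2 ^ l →
        0 ≤ (e - (a / (r * 2 ^ l : ℕ) - 1) * (r * 2 ^ l)) / 2 ^ l ∧
        (e - (a / (r * 2 ^ l : ℕ) - 1) * (r * 2 ^ l)) / 2 ^ l < 3 * r ∧
        (a / (r * 2 ^ l : ℕ) - 1) * (r * 2 ^ l) + 2 ^ l *
          ((e - (a / (r * 2 ^ l : ℕ) - 1) * (r * 2 ^ l)) / 2 ^ l) ≤ e ∧
        e < (a / (r * 2 ^ l : ℕ) - 1) * (r * 2 ^ l) + 2 ^ l *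
          ((e - (a / (r * 2 ^ l : ℕ) - 1) * (r * 2 ^ l)) / 2 ^ l) + 2 ^ l := by
      intro a e hae
      zify at hae
      rw [abs_le] at hae
      have hs : (0 : ℤ) < r * 2 ^ l := by positivity
      have h2 : (0 : ℤ) < 2 ^ l := by positivity
      have hx := Int.emod_add_mul_ediv a (r * 2 ^ l)
      have h1 := Int.emod_nonneg a hs.ne'
      have h3 := Int.emod_lt_of_pos a hs
      push_cast
      generalize a / (r * 2 ^ l : ℤ) = f at *
      have hx' := Int.emod_add_mul_ediv (e - (f - 1) * (r * 2 ^ l)) (2 ^ l)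
      have h1' := Int.emod_nonneg (e - (f - 1) * (r * 2 ^ l)) h2.ne'
      have h3' := Int.emod_lt_of_pos (e - (f - 1) * (r * 2 ^ l)) h2
      refine ⟨Int.ediv_nonneg ?_ h2.le, ?_, ?_, ?_⟩
      · nlinarith
      · rw [Int.ediv_lt_iff_lt_mul h2]
        nlinarith
      · linarith
      · linarith
    obtain ⟨h1, h2⟩ := max_le_iff.1 h
    obtain ⟨a1, a2, a3, a4⟩ := key _ _ h1
    obtain ⟨b1, b2, b3, b4⟩ := key _ _ h2
    set t : ℤ × ℤ := ((x.1 - w.1) / 2 ^ l, (x.2 - w.2) / 2 ^ l) with ht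
    have htm : t ∈ square (3 * r) := by
      simp only [square, Finset.mem_product, Finset.mem_Ico]
      push_cast
      exact ⟨⟨a1, a2⟩, b1, b2⟩
    have hxm : x ∈ box l (gridPt w (2 ^ l) t) := by
      simp only [box, gridPt, Finset.mem_product, Finset.mem_Ico]
      push_cast
      exact ⟨⟨a3, a4⟩, b3, b4⟩
    have h3 := Finset.single_le_sum (f := fun t => boxBound θ l Y (gridPt w (2 ^ l) t))
      (fun t _ => boxBound_nonneg _ _ _ _) htm
    have h4 := exp_le_boxBound θ Y hxm
    rw [regionBound]
    linarith

/-! ### Independence over separated cells. -/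

section Expectation

theorem lintegral_prod_of_iIndep {Ω ι κ : Type*} [MeasurableSpace Ω] {μ : Measure Ω}
    [IsProbabilityMeasure μ] {m : ι → MeasurableSpace Ω} (hm : ∀ i, m i ≤ ‹MeasurableSpace Ω›)
    (hind : iIndep m μ) (S : κ → Set ι) (G : κ → Ω → ENNReal)
    (hG : ∀ c, Measurable[⨆ i ∈ S c, m i] (G c)) (C : Finset κ)
    (hC : ∀ c ∈ C, ∀ e ∈ C, c ≠ e → Disjoint (S c) (S e)) :
    ∫⁻ ω, ∏ c ∈ C, G c ω ∂μ = ∏ c ∈ C, ∫⁻ ω, G c ω ∂μ := by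
  classical
  induction C using Finset.induction_on with
  | empty => simp
  | insert c C hc ih =>
    simp only [Finset.prod_insert hc]
    rw [← ih fun x hx y hy => hC x (Finset.mem_insert_of_mem hx) y (Finset.mem_insert_of_mem hy)]
    have hdisj : Disjoint (S c) (⋃ e ∈ C, S e) := by
      simp only [Set.disjoint_iUnion_right]
      intro e he
      exact hC c (Finset.mem_insert_self _ _) e (Finset.mem_insert_of_mem he)
        (by rintro rfl; exact hc he)
    refine lintegral_mul_eq_lintegral_mul_lintegral_of_independent_measurableSpace
      (iSup₂_le fun i _ => hm i) (iSup₂_le fun i _ => hm i)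
      (indep_iSup_of_disjoint hm hind hdisj) (hG c) ?_
    refine Finset.measurable_prod _ fun e he => (hG e).mono ?_ le_rfl
    exact iSup₂_le fun i hi => le_iSup₂_of_le i (Set.mem_biUnion he hi) le_rfl

/-- A noise box meeting the `3 × 3` block of cells has its lower left corner at most one further
cell to the left or below, since `2 ^ (j * k) ≤ r * 2 ^ (j * k)`. The relevant corners fill a `4 ×
4` block, so cells at distance at least `4` use disjoint noise. -/
theorem measurable_regionBound_levelSum {Ω : Type*} {b : ℕ → ℤ × ℤ → Ω → ℝ}
    {m : ℤ × ℤ → MeasurableSpace Ω}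
    {k r j : ℕ} (hr : 0 < r)
    (hm : ∀ c, Measurable[m c] (b (j * k) c)) (θ : ℝ) (c : ℤ × ℤ) :
    Measurable[⨆ e ∈ {e : ℤ × ℤ |
      ((c.1 - 2) * (r * 2 ^ (j * k)) ≤ e.1 ∧ e.1 < (c.1 + 2) * (r * 2 ^ (j * k))) ∧
      ((c.2 - 2) * (r * 2 ^ (j * k)) ≤ e.2 ∧ e.2 < (c.2 + 2) * (r * 2 ^ (j * k)))}, m e]
      fun ω => regionBound θ (j * k) r (levelSum b k {j} ω) c := by
  refine (Finset.measurable_sum _ fun t ht => ?_).const_add _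
  refine measurable_boxBound_levelSum θ fun y hy => ?_
  simp only [levelSum, Finset.sum_singleton]
  refine Finset.measurable_sum _ fun e he => Measurable.const_mul ?_ _
  refine (hm e).mono (le_iSup₂_of_le e ?_ le_rfl) le_rfl
  simp only [square, box, gridPt, boxesAt, Finset.mem_product, Finset.mem_Ico, Finset.mem_Ioc]
    at ht hy he
  have key : ∀ c t y e : ℤ, 0 ≤ t → t < (3 * r : ℕ) →
      (c - 1) * (r * 2 ^ (j * k)) + (2 ^ (j * k) : ℕ) * t ≤ y →
      y < (c - 1) * (r * 2 ^ (j * k)) + (2 ^ (j * k) : ℕ) * t + 2 ^ (j * k) →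
      y - 2 ^ (j * k) < e → e ≤ y →
      (c - 2) * (r * 2 ^ (j * k)) ≤ e ∧ e < (c + 2) * (r * 2 ^ (j * k)) := by
    intro c t y e h1 h2 h3 h4 h5 h6
    push_cast at *
    have hs : (0 : ℤ) < 2 ^ (j * k) := by positivity
    generalize (2 : ℤ) ^ (j * k) = s at *
    have hr' : (1 : ℤ) ≤ r := by exact_mod_cast hr
    constructor <;> nlinarith
  exact ⟨key _ _ _ _ ht.1.1 ht.1.2 hy.1.1 hy.1.2 he.1.1 he.1.2,
    key _ _ _ _ ht.2.1 ht.2.2 hy.2.1 hy.2.2 he.2.1 he.2.2⟩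

variable {Ω : Type*} [MeasurableSpace Ω] {μ : Measure Ω} {b : ℕ → ℤ × ℤ → Ω → ℝ}

theorem IsBoxNoise.lintegral_regionBound_le [IsProbabilityMeasure μ] (hb : IsBoxNoise μ b)
    {k r : ℕ} (hk : 1 ≤ k) (hr : 0 < r) (j : ℕ) (c : ℤ × ℤ) (θ : ℝ) :
    ∫⁻ ω, ENNReal.ofReal (regionBound θ (j * k) r (levelSum b k {j} ω) c) ∂μ ≤
      ENNReal.ofReal (40000 * r ^ 2 * Real.exp (128 * k * θ ^ 2)) := by
  unfold regionBound
  generalize (((c.1 - 1) * (r * 2 ^ (j * k)), (c.2 - 1) * (r * 2 ^ (j * k))) : ℤ × ℤ) = w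
  have hmeas : ∀ z, Measurable fun ω => boxBound θ (j * k) (levelSum b k {j} ω) z := fun z =>
    measurable_boxBound_levelSum θ fun y _ => hb.measurable_levelSum k {j} y
  calc _ = ∫⁻ ω, (1 + ∑ t ∈ square (3 * r), ENNReal.ofReal
        (boxBound θ (j * k) (levelSum b k {j} ω) (gridPt w (2 ^ (j * k)) t))) ∂μ := by
        refine lintegral_congr fun ω => ?_
        rw [ENNReal.ofReal_add one_pos.le (Finset.sum_nonneg fun _ _ => boxBound_nonneg _ _ _ _),
          ENNReal.ofReal_one, ENNReal.ofReal_sum_of_nonneg fun _ _ => boxBound_nonneg _ _ _ _]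
    _ = 1 + ∑ t ∈ square (3 * r), ∫⁻ ω, ENNReal.ofReal
        (boxBound θ (j * k) (levelSum b k {j} ω) (gridPt w (2 ^ (j * k)) t)) ∂μ := by
        rw [lintegral_add_left measurable_const,
          lintegral_finsetSum _ fun t _ => (hmeas _).ennreal_ofReal]
        simp
    _ ≤ 1 + ∑ t ∈ square (3 * r), ENNReal.ofReal (1 / 2 * Real.exp (2 * θ ^ 2 * k * 1) +
        2048 * (1 + Real.exp (128 * k * θ ^ 2))) := by
        gcongr with t
        refine (hb.lintegral_boxBound_le hk (j₀ := j) (by simp) _ θ).trans_eq ?_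
        simp
    _ = ENNReal.ofReal (1 + (3 * r) ^ 2 * (1 / 2 * Real.exp (2 * θ ^ 2 * k * 1) +
        2048 * (1 + Real.exp (128 * k * θ ^ 2)))) := by
        rw [Finset.sum_const, card_square, nsmul_eq_mul, ← ENNReal.ofReal_natCast,
          ← ENNReal.ofReal_mul (by positivity), ← ENNReal.ofReal_one,
          ← ENNReal.ofReal_add (by norm_num) (by positivity)]
        push_cast
        rfl
    _ ≤ _ := by
        refine ENNReal.ofReal_le_ofReal ?_
        have h0 : 0 ≤ (k : ℝ) * θ ^ 2 := by positivity
        have h1 : 1 ≤ Real.exp (128 * k * θ ^ 2) := Real.one_le_exp (by linarith)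
        have h2 : Real.exp (2 * θ ^ 2 * k * 1) ≤ Real.exp (128 * k * θ ^ 2) :=
          Real.exp_le_exp.2 (by linarith)
        have h3 : (1 : ℝ) ≤ r ^ 2 := one_le_pow₀ (by exact_mod_cast hr)
        generalize Real.exp (128 * k * θ ^ 2) = E at *
        have h4 : 0 ≤ (r : ℝ) ^ 2 * E := by positivity
        -- The coefficient is `1 + 9 * (1 / 2 + 4096) = 36869.5`, rounded up to `40000`.
        calc 1 + (3 * (r : ℝ)) ^ 2 * (1 / 2 * Real.exp (2 * θ ^ 2 * k * 1) + 2048 * (1 + E))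
            ≤ r ^ 2 * E + (3 * (r : ℝ)) ^ 2 * (1 / 2 * E + 2048 * (E + E)) := by
              gcongr
              exact one_le_mul_of_one_le_of_one_le h3 h1
          _ ≤ _ := by linarith

theorem IsBoxNoise.lintegral_prod_regionBound_le [IsProbabilityMeasure μ] (hb : IsBoxNoise μ b)
    {k r : ℕ} (hk : 1 ≤ k) (hr : 0 < r) (j : ℕ) (θ : ℝ) {C : Finset (ℤ × ℤ)}
    (hC : ∀ c ∈ C, ∀ e ∈ C, c ≠ e → 4 ≤ supDist c e) :
    ∫⁻ ω, ENNReal.ofReal (∏ c ∈ C, regionBound θ (j * k) r (levelSum b k {j} ω) c) ∂μ ≤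
      ENNReal.ofReal ((40000 * r ^ 2 * Real.exp (128 * k * θ ^ 2)) ^ C.card) := by
  simp_rw [ENNReal.ofReal_prod_of_nonneg fun c _ => (regionBound_pos _ _ _ _ c).le]
  rw [lintegral_prod_of_iIndep (m := fun c => MeasurableSpace.comap (b (j * k) c) inferInstance)
    (fun c => (hb.measurable _ c).comap_le)
    (hb.indep.precomp (g := fun c : ℤ × ℤ => (j * k, c)) fun x y h => (Prod.mk.inj h).2).iIndep _
    _ (fun c => (measurable_regionBound_levelSum hr
      (fun e => comap_measurable (b (j * k) e)) θ c).ennreal_ofReal)]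
  · rw [ENNReal.ofReal_pow (by positivity)]
    exact Finset.prod_le_pow_card _ _ _ fun c _ => hb.lintegral_regionBound_le hk hr j c θ
  · intro c hc e he hce
    have hs : (0 : ℤ) < r * 2 ^ (j * k) := by positivity
    have h4 := hC c hc e he hce
    refine Set.disjoint_left.2 fun x hx hx' => ?_
    simp only [Set.mem_ofPred_eq] at hx hx'
    generalize (r * 2 ^ (j * k) : ℤ) = s at *
    have key : ∀ c e x : ℤ, (c - 2) * s ≤ x → x < (e + 2) * s → c < e + 4 := by
      intro c e x h1 h2
      have := lt_of_mul_lt_mul_right (h1.trans_lt h2) hs.le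
      linarith
    have h5 := key _ _ _ hx.1.1 hx'.1.2
    have h6 := key _ _ _ hx'.1.1 hx.1.2
    have h7 := key _ _ _ hx.2.1 hx'.2.2
    have h8 := key _ _ _ hx'.2.1 hx.2.2
    unfold supDist at h4
    omega

theorem IsBoxNoise.measure_le_prod_regionBound_le [IsProbabilityMeasure μ] (hb : IsBoxNoise μ b)
    {k r : ℕ} (hk : 1 ≤ k) (hr : 0 < r) (j : ℕ) (θ x : ℝ) {C : Finset (ℤ × ℤ)}
    (hC : ∀ c ∈ C, ∀ e ∈ C, c ≠ e → 4 ≤ supDist c e) :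
    μ {ω | Real.exp (x * C.card) ≤ ∏ c ∈ C, regionBound θ (j * k) r (levelSum b k {j} ω) c} ≤
      ENNReal.ofReal ((40000 * r ^ 2 * Real.exp (128 * k * θ ^ 2 - x)) ^ C.card) := by
  have hm : Measurable fun ω => ENNReal.ofReal
      (∏ c ∈ C, regionBound θ (j * k) r (levelSum b k {j} ω) c) :=
    (Finset.measurable_prod _ fun c _ => (Finset.measurable_sum _ fun t _ =>
      measurable_boxBound_levelSum θ fun y _ => hb.measurable_levelSum k {j} y).const_add
        _).ennreal_ofReal
  have h := (mul_meas_ge_le_lintegral (μ := μ) hm (ENNReal.ofReal (Real.exp (x * C.card)))).trans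
    (hb.lintegral_prod_regionBound_le hk hr j θ hC)
  rw [mul_comm, ← ENNReal.le_div_iff_mul_le (by simp [Real.exp_pos]) (by simp),
    ← ENNReal.ofReal_div_of_pos (Real.exp_pos _)] at h
  refine (measure_mono fun ω hω => ENNReal.ofReal_le_ofReal hω).trans (h.trans_eq ?_)
  congr 1
  rw [Real.exp_sub, ← mul_div_assoc, div_pow, mul_comm x, Real.exp_nat_mul]

end Expectation

/-! ### Union bounds over trees, and zeros of the Bernoulli field. -/

section Union

variable {Ω : Type*} [MeasurableSpace Ω] {μ : Measure Ω}

theorem measure_exists_trees_le {A d : ℕ} (hA : 0 < A) (hd : 2 ≤ d) (h : ℕ)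
    (R : Finset (ℤ × ℤ)) (p : Finset (ℤ × ℤ) → Prop) (E : Finset (ℤ × ℤ) → Set Ω) (x : ENNReal)
    (hx : ∀ C, p C → μ (E C) ≤ x) :
    μ {ω | ∃ c ∈ R, ∃ C ∈ trees A d h c, p C ∧ ω ∈ E C} ≤
      R.card * ((9 * A ^ 2 : ℕ) ^ (2 * d ^ h) * x) := by
  classical
  have hsub : {ω | ∃ c ∈ R, ∃ C ∈ trees A d h c, p C ∧ ω ∈ E C} ⊆
      ⋃ c ∈ R, ⋃ C ∈ (trees A d h c).filter p, E C := by
    rintro ω ⟨c, hc, C, hC, hp, hω⟩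
    simp only [Set.mem_iUnion]
    exact ⟨c, hc, C, Finset.mem_filter.2 ⟨hC, hp⟩, hω⟩
  refine (measure_mono hsub).trans ((measure_biUnion_finset_le _ _).trans ?_)
  rw [← nsmul_eq_mul]
  refine Finset.sum_le_card_nsmul _ _ _ fun c _ => (measure_biUnion_finset_le _ _).trans ?_
  refine (Finset.sum_le_card_nsmul _ _ x fun C hC => hx C (Finset.mem_filter.1 hC).2).trans ?_
  rw [nsmul_eq_mul]
  gcongr
  have h1 := (Finset.card_filter_le (trees A d h c) p).trans (card_trees_le hA hd h c)
  have h2 : (9 * A ^ 2) ^ (2 * (d ^ h - 1)) ≤ (9 * A ^ 2) ^ (2 * d ^ h) :=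
    Nat.pow_le_pow_right (by positivity) (by omega)
  exact_mod_cast h1.trans h2

/-- Vertices are split off one at a time: each is farther than `q` from all the others, so
`q`-dependence separates it from the whole remaining set. -/
theorem IsBernoulliField.measure_forall_eq_zero_le [IsProbabilityMeasure μ] {n q : ℕ} {p : ℝ}
    {ξ : ℤ × ℤ → Ω → ℕ} (hξ : IsBernoulliField μ n q p ξ) {S : Finset (ℤ × ℤ)} (hS : S ⊆ V n)
    (hsep : ∀ x ∈ S, ∀ y ∈ S, x ≠ y → q < supDist x y) :
    μ {ω | ∀ w ∈ S, ξ w ω = 0} ≤ ENNReal.ofReal (1 - p) ^ S.card := by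
  classical
  induction S using Finset.induction_on with
  | empty => simp
  | insert w S hw ih =>
    have hwV : w ∈ V n := hS (Finset.mem_insert_self _ _)
    have hSV : S ⊆ V n := (Finset.subset_insert _ _).trans hS
    have hind := hξ.dependent S hSV {w} (by simpa using hwV) (fun z hz y hy => by
      rw [Finset.mem_singleton] at hy
      subst hy
      exact hsep z (Finset.mem_insert_of_mem hz) y (Finset.mem_insert_self _ _)
        (by rintro rfl; exact hw hz))
    have hone : μ {ω | ξ w ω = 0} ≤ ENNReal.ofReal (1 - p) := by
      have hcompl : {ω | ξ w ω = 0} = {ω | ξ w ω = 1}ᶜ := by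
        ext ω
        have := hξ.zero_or_one w hwV ω
        simp only [Set.mem_ofPred_eq, Set.mem_compl_iff]
        omega
      have hm : MeasurableSet {ω | ξ w ω = 1} := hξ.measurable w hwV (measurableSet_singleton 1)
      rw [← ofReal_measureReal, hcompl, probReal_compl_eq_one_sub hm]
      exact ENNReal.ofReal_le_ofReal (by linarith [hξ.density w hwV])
    have h1 := hind.measure_inter_preimage_eq_mul {f | ∀ z, f z = 0} {f | ∀ z, f z = 0}
      (by
        rw [Set.ofPred_forall]
        exact MeasurableSet.iInter fun z => measurable_pi_apply z (measurableSet_singleton 0))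
      (by
        rw [Set.ofPred_forall]
        exact MeasurableSet.iInter fun z => measurable_pi_apply z (measurableSet_singleton 0))
    have h2 : {ω | ∀ z ∈ insert w S, ξ z ω = 0} =
        (fun ω (z : S) => ξ z ω) ⁻¹' {f | ∀ z, f z = 0} ∩
        (fun ω (z : ({w} : Finset (ℤ × ℤ))) => ξ z ω) ⁻¹' {f | ∀ z, f z = 0} := by
      ext ω
      simp only [Finset.forall_mem_insert, Set.mem_inter_iff, Set.mem_preimage, Set.mem_ofPred_eq,
        Subtype.forall, Finset.mem_singleton, forall_eq, and_comm]
    rw [h2, h1, Finset.card_insert_of_notMem hw, pow_succ]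
    refine mul_le_mul' (le_trans (le_of_eq ?_) (ih hSV fun x hx y hy =>
      hsep x (Finset.mem_insert_of_mem hx) y (Finset.mem_insert_of_mem hy)))
      (le_trans (le_of_eq ?_) hone)
    · congr 1; ext ω; simp
    · congr 1; ext ω
      simp only [Set.mem_preimage, Set.mem_ofPred_eq, Subtype.forall, Finset.mem_singleton,
        forall_eq]

/-- There are at most `2 ^ C.card` candidate sets of zeros. Each has at least `C.card / 4` vertices
and so probability at most `(η ^ 4) ^ (C.card / 4)`. -/
theorem IsBernoulliField.measure_card_zeros_le [IsProbabilityMeasure μ] {n q : ℕ} {p η : ℝ}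
    {ξ : ℤ × ℤ → Ω → ℕ} (hξ : IsBernoulliField μ n q p ξ) (hη0 : 0 ≤ η) (hη1 : η ≤ 1)
    (hη : 1 - p ≤ η ^ 4) {C : Finset (ℤ × ℤ)} (hC : C ⊆ V n)
    (hsep : ∀ x ∈ C, ∀ y ∈ C, x ≠ y → q < supDist x y) :
    μ {ω | C.card ≤ 4 * (C.filter fun w => ξ w ω = 0).card} ≤
      ENNReal.ofReal ((2 * η) ^ C.card) := by
  classical
  have hsub : {ω | C.card ≤ 4 * (C.filter fun w => ξ w ω = 0).card} ⊆
      ⋃ S ∈ C.powerset.filter fun S => C.card ≤ 4 * S.card, {ω | ∀ w ∈ S, ξ w ω = 0} := by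
    intro ω hω
    simp only [Set.mem_iUnion]
    exact ⟨C.filter fun w => ξ w ω = 0, Finset.mem_filter.2
      ⟨Finset.mem_powerset.2 (Finset.filter_subset _ _), hω⟩, fun w hw => (Finset.mem_filter.1 hw).2⟩
  refine (measure_mono hsub).trans ((measure_biUnion_finset_le _ _).trans ?_)
  refine (Finset.sum_le_card_nsmul _ _ (ENNReal.ofReal (η ^ C.card)) fun S hS => ?_).trans ?_
  · rw [Finset.mem_filter, Finset.mem_powerset] at hS
    refine (hξ.measure_forall_eq_zero_le (hS.1.trans hC) fun x hx y hy =>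
      hsep x (hS.1 hx) y (hS.1 hy)).trans ?_
    calc ENNReal.ofReal (1 - p) ^ S.card ≤ ENNReal.ofReal (η ^ 4) ^ S.card := by gcongr
      _ = ENNReal.ofReal (η ^ (4 * S.card)) := by
        rw [← ENNReal.ofReal_pow (by positivity), pow_mul]
      _ ≤ _ := ENNReal.ofReal_le_ofReal (pow_le_pow_of_le_one hη0 hη1 hS.2)
  · rw [nsmul_eq_mul, mul_pow, ENNReal.ofReal_mul (by positivity)]
    gcongr
    rw [← ENNReal.ofReal_natCast]
    refine ENNReal.ofReal_le_ofReal ?_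
    have := (Finset.card_filter_le C.powerset fun S => C.card ≤ 4 * S.card)
    rw [Finset.card_powerset] at this
    exact_mod_cast this

end Union

/-! ### Maximum of the top levels over `V n`. -/

variable {Ω : Type*}

theorem card_image_cell_le (n l : ℕ) :
    ((V n).image (cell ((2 : ℤ) ^ l))).card ≤ (2 ^ n / 2 ^ l + 1) ^ 2 := by
  have hsub : (V n).image (cell ((2 : ℤ) ^ l)) ⊆ square (2 ^ n / 2 ^ l + 1) := by
    have key : ∀ x : ℤ, 0 ≤ x → x < 2 ^ n →
        0 ≤ x / 2 ^ l ∧ x / 2 ^ l < (2 ^ n / 2 ^ l + 1 : ℕ) := by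
      intro x h0 h1
      refine ⟨Int.ediv_nonneg h0 (by positivity), ?_⟩
      push_cast
      exact Int.lt_add_one_of_le (Int.ediv_le_ediv (by positivity) h1.le)
    intro c hc
    obtain ⟨z, hz, rfl⟩ := Finset.mem_image.1 hc
    simp only [V, Finset.mem_product, Finset.mem_Ico] at hz
    simp only [square, cell, Finset.mem_product, Finset.mem_Ico]
    exact ⟨key _ hz.1.1 hz.1.2, key _ hz.2.1 hz.2.2⟩
  exact (Finset.card_le_card hsub).trans_eq (card_square _)

theorem mem_box_gridPt_cell (l : ℕ) (z : ℤ × ℤ) :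
    z ∈ box l (gridPt (0, 0) (2 ^ l) (cell ((2 : ℤ) ^ l) z)) := by
  have h2 : (0 : ℤ) < 2 ^ l := by positivity
  have key : ∀ x : ℤ, 0 + ((2 ^ l : ℕ) : ℤ) * (x / 2 ^ l) ≤ x ∧
      x < 0 + ((2 ^ l : ℕ) : ℤ) * (x / 2 ^ l) + 2 ^ l := by
    intro x
    have hx := Int.emod_add_mul_ediv x (2 ^ l)
    have h1 := Int.emod_nonneg x h2.ne'
    have h3 := Int.emod_lt_of_pos x h2
    push_cast
    constructor <;> linarith
  simp only [box, gridPt, cell, Finset.mem_product, Finset.mem_Ico]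
  exact ⟨key _, key _⟩

/-- The levels in `J` vary little inside a box of side `2 ^ (j₀ * k)`, so one Chernoff bound for
each such box covering `V n` suffices. -/
theorem IsBoxNoise.measure_exists_le_levelSum_le [MeasurableSpace Ω] {μ : Measure Ω}
    [IsProbabilityMeasure μ] {b : ℕ → ℤ × ℤ → Ω → ℝ} (hb : IsBoxNoise μ b) {k j₀ : ℕ}
    (hk : 1 ≤ k) {J : Finset ℕ} (hJ : ∀ j ∈ J, j₀ ≤ j) (n : ℕ) {θ : ℝ} (hθ : 0 ≤ θ) (x : ℝ) :
    μ {ω | ∃ z ∈ V n, x ≤ levelSum b k J ω z} ≤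
      ENNReal.ofReal (((2 : ℝ) ^ n / 2 ^ (j₀ * k) + 1) ^ 2 *
        ((1 / 2 * Real.exp (2 * θ ^ 2 * k * J.card) + 2048 * (1 + Real.exp (128 * k * θ ^ 2))) *
          Real.exp (-(θ * x)))) := by
  set l := j₀ * k
  set R := (V n).image (cell ((2 : ℤ) ^ l))
  set B := 1 / 2 * Real.exp (2 * θ ^ 2 * k * J.card) + 2048 * (1 + Real.exp (128 * k * θ ^ 2))
  have hB : 0 ≤ B := by positivity
  have hsub : {ω | ∃ z ∈ V n, x ≤ levelSum b k J ω z} ⊆ ⋃ c ∈ R, {ω | ENNReal.ofReal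
      (Real.exp (θ * x)) ≤
        ENNReal.ofReal (boxBound θ l (levelSum b k J ω) (gridPt (0, 0) (2 ^ l) c))} := by
    rintro ω ⟨z, hz, hx⟩
    simp only [Set.mem_iUnion]
    refine ⟨cell ((2 : ℤ) ^ l) z, Finset.mem_image_of_mem _ hz, ENNReal.ofReal_le_ofReal ?_⟩
    exact (Real.exp_le_exp.2 (mul_le_mul_of_nonneg_left hx hθ)).trans
      (exp_le_boxBound θ (levelSum b k J ω) (mem_box_gridPt_cell l z))
  refine (measure_mono hsub).trans ((measure_biUnion_finset_le _ _).trans ?_)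
  refine (Finset.sum_le_card_nsmul _ _ (ENNReal.ofReal (B * Real.exp (-(θ * x))))
    fun c _ => ?_).trans ?_
  · have h := (mul_meas_ge_le_lintegral (μ := μ) (measurable_boxBound_levelSum θ
      fun y _ => hb.measurable_levelSum k J y).ennreal_ofReal (ENNReal.ofReal
      (Real.exp (θ * x)))).trans (hb.lintegral_boxBound_le hk hJ (gridPt (0, 0) (2 ^ l) c) θ)
    rw [mul_comm, ← ENNReal.le_div_iff_mul_le (by simp [Real.exp_pos]) (by simp),
      ← ENNReal.ofReal_div_of_pos (Real.exp_pos _), div_eq_mul_inv, ← Real.exp_neg] at h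
    exact h
  · rw [nsmul_eq_mul, ENNReal.ofReal_mul (p := ((2 : ℝ) ^ n / 2 ^ l + 1) ^ 2) (by positivity)]
    refine mul_le_mul_left ?_ _
    rw [← ENNReal.ofReal_natCast]
    refine ENNReal.ofReal_le_ofReal ?_
    have h1 : (R.card : ℝ) ≤ ((2 ^ n / 2 ^ l + 1) ^ 2 : ℕ) := by
      exact_mod_cast card_image_cell_le n l
    refine h1.trans ?_
    push_cast
    gcongr
    exact Nat.cast_div_le.trans_eq (by push_cast; rfl)

/-! ### Deterministic argument on a single path. -/

theorem levelSum_eq_sum (b : ℕ → ℤ × ℤ → Ω → ℝ) (k : ℕ) (J : Finset ℕ) (ω : Ω) (z : ℤ × ℤ) :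
    levelSum b k J ω z = ∑ j ∈ J, levelSum b k {j} ω z := by
  simp [levelSum]

theorem four_mul_card_filter_le {α : Type*} {D : Finset α} {f : α → ℝ} {y : ℝ} (hy : 0 < y)
    (hf : ∀ x ∈ D, 0 ≤ f x) (h : ∑ x ∈ D, f x ≤ y * D.card) :
    4 * (D.filter fun x => 4 * y < f x).card ≤ D.card := by
  have h1 : ((D.filter fun x => 4 * y < f x).card : ℝ) * (4 * y) ≤ y * D.card := by
    refine le_trans ?_ h
    rw [← nsmul_eq_mul]
    refine (Finset.card_nsmul_le_sum _ _ _ fun x hx => (Finset.mem_filter.1 hx).2.le).trans ?_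
    exact Finset.sum_le_sum_of_subset_of_nonneg (Finset.filter_subset _ _) fun x hx _ => hf x hx
  have h2 : (4 : ℝ) * (D.filter fun x => 4 * y < f x).card ≤ D.card := by
    refine le_of_mul_le_mul_left ?_ hy
    linarith
  exact_mod_cast h2

/-- A configuration without atypical trees has many good vertices on each long path. -/
theorem half_le_card_filter {b : ℕ → ℤ × ℤ → Ω → ℝ} {ξ : ℤ × ℤ → Ω → ℕ} {ω : Ω}
    {n k q a ρ d h : ℕ} {θ ε T : ℝ} {J J' : Finset ℕ} {i : ℕ → ℕ} {R : Finset (ℤ × ℤ)}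
    (hn : 1 ≤ n) (hε : 0 < ε) (hθ : 0 < θ) (hρ : 6 ≤ ρ) (hqρ : q + 2 < ρ)
    (hd : d * ρ ≤ 2 ^ a) (hJk : J.card * k ≤ n)
    (hdisj : Disjoint J J') (hJJ : J ∪ J' = Finset.range (n / k))
    (hi : ∀ j ∈ J, i j ≤ h ∧ j * k ≤ a * i j)
    (hR : ∀ z ∈ V n, cell ((2 ^ a) ^ h : ℕ) z ∈ R)
    (hξ : ∀ w ∈ V n, ξ w ω = 0 ∨ ξ w ω = 1)
    (htop : ∀ z ∈ V n, levelSum b k J' ω z < T)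
    (hlow : ∀ j ∈ J, ¬ ∃ c ∈ R, ∃ C ∈ trees (2 ^ a) d (h - i j) c,
      ((∀ x ∈ C, ∀ y ∈ C, x ≠ y → 4 ≤ supDist x y) ∧ C.card = d ^ (h - i j)) ∧
      Real.exp (θ * (ε * k) * C.card) ≤
        ∏ c ∈ C, regionBound θ (j * k) (2 ^ (a * i j - j * k)) (levelSum b k {j} ω) c)
    (hzero : ¬ ∃ c ∈ R, ∃ C ∈ trees (2 ^ a) d h c,
      (C ⊆ V n ∧ (∀ x ∈ C, ∀ y ∈ C, x ≠ y → q < supDist x y) ∧ C.card = d ^ h) ∧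
      C.card ≤ 4 * (C.filter fun w => ξ w ω = 0).card)
    {u v : ℤ × ℤ} (P : grid.Walk u v) (hP : vertices P ⊆ V n)
    {z y : ℤ × ℤ} (hz : z ∈ vertices P) (hy : y ∈ vertices P) (hzy : (2 ^ a) ^ h ≤ supDist z y) :
    d ^ h ≤ 2 * ((vertices P).filter fun w =>
      phi b n k w ω ≤ 4 * (ε * n) + T ∧ ξ w ω = 1).card := by
  classical
  obtain ⟨D, hD⟩ := exists_tree (by positivity) (by omega) hd (P := (vertices P : Set (ℤ × ℤ)))
    (exists_mem_vertices_supDist_eq P) h z hz ⟨y, hy, hzy⟩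
  have hzR := hR z (hP hz)
  have hsep : ∀ i ≤ h, ∀ x ∈ D i, ∀ y ∈ D i, x ≠ y →
      ρ - 2 ≤ supDist (cell ((2 ^ a) ^ i : ℕ) x) (cell ((2 ^ a) ^ i : ℕ) y) := fun i hi x hx y hy hxy =>
    le_supDist_cell (by positivity) ((hD i hi).2.2.2.1 x hx y hy hxy)
  have hinj : ∀ i ≤ h, Set.InjOn (cell ((2 ^ a) ^ i : ℕ)) (D i : Set (ℤ × ℤ)) := by
    intro i hi x hx y hy hxy
    by_contra hne
    have := hsep i hi x hx y hy hne
    rw [hxy, supDist_self] at this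
    omega
  have hsep' : ∀ i ≤ h, ∀ x ∈ (D i).image (cell ((2 ^ a) ^ i : ℕ)),
      ∀ y ∈ (D i).image (cell ((2 ^ a) ^ i : ℕ)), x ≠ y → ρ - 2 ≤ supDist x y := by
    intro i hi x hx y hy hxy
    obtain ⟨x', hx', rfl⟩ := Finset.mem_image.1 hx
    obtain ⟨y', hy', rfl⟩ := Finset.mem_image.1 hy
    exact hsep i hi x' hx' y' hy' (by rintro rfl; exact hxy rfl)
  obtain ⟨hDP, -, hDcard, -, hDtree, -⟩ := hD 0 (Nat.zero_le h)
  rw [Nat.sub_zero] at hDcard hDtree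
  have hsum : ∀ j ∈ J, ∑ x ∈ D 0, max (levelSum b k {j} ω x) 0 ≤ ε * k * d ^ h := by
    intro j hj
    obtain ⟨hih, hjk⟩ := hi j hj
    have hpow : (2 ^ a) ^ i j = 2 ^ (a * i j - j * k) * 2 ^ (j * k) := by
      rw [← pow_mul, ← pow_add, Nat.sub_add_cancel hjk]
    obtain ⟨-, -, hcard, -, htree, hcmp⟩ := hD (i j) hih
    set G := regionBound θ (j * k) (2 ^ (a * i j - j * k)) (levelSum b k {j} ω) with hG
    have hGpos : ∀ c, 0 < G c := regionBound_pos _ _ _ _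
    -- The positive part of level `j` at a leaf is bounded through the region around its ancestor in
    -- generation `i j`, and each ancestor has `d ^ i j` leaves below it.
    have h1 := hcmp (fun x => max (levelSum b k {j} ω x) 0)
      (fun y => θ⁻¹ * Real.log (G (cell ((2 ^ a) ^ i j : ℕ) y))) (by
        intro x y hxy
        rw [hpow] at hxy ⊢
        rw [inv_mul_eq_div, le_div_iff₀ hθ, mul_comm, Real.le_log_iff_exp_le (hGpos _)]
        exact exp_le_regionBound (by positivity) _ hxy)
    have h2 : ¬ Real.exp (θ * (ε * k) * ((D (i j)).image (cell ((2 ^ a) ^ i j : ℕ))).card) ≤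
        ∏ c ∈ (D (i j)).image (cell ((2 ^ a) ^ i j : ℕ)), G c := fun hle =>
      hlow j hj ⟨_, hzR, _, htree, ⟨fun x hx y hy hxy =>
        le_trans (by omega) (hsep' _ hih x hx y hy hxy),
        by rw [Finset.card_image_of_injOn (hinj _ hih), hcard]⟩, hle⟩
    rw [Finset.card_image_of_injOn (hinj _ hih), Finset.prod_image (hinj _ hih), hcard, not_le,
      ← Real.log_lt_iff_lt_exp (Finset.prod_pos fun c _ => hGpos _),
      Real.log_prod fun c _ => (hGpos _).ne'] at h2
    refine h1.trans ?_
    rw [← Finset.mul_sum]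
    calc (d : ℝ) ^ i j * (θ⁻¹ * ∑ y ∈ D (i j), Real.log (G (cell ((2 ^ a) ^ i j : ℕ) y)))
        ≤ (d : ℝ) ^ i j * (θ⁻¹ * (θ * (ε * k) * (d ^ (h - i j) : ℕ))) := by gcongr
      _ = ε * k * (d ^ i j * d ^ (h - i j)) := by push_cast; field_simp
      _ = _ := by rw [← pow_add, Nat.add_sub_cancel' hih]
  have hbad := four_mul_card_filter_le (D := D 0)
    (f := fun x => ∑ j ∈ J, max (levelSum b k {j} ω x) 0) (y := ε * n)
    (by have : (1 : ℝ) ≤ n := by exact_mod_cast hn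
        positivity)
    (fun x _ => Finset.sum_nonneg fun j _ => le_max_right _ _) (by
      rw [Finset.sum_comm]
      refine (Finset.sum_le_card_nsmul _ _ _ hsum).trans ?_
      rw [nsmul_eq_mul, hDcard]
      have : (J.card : ℝ) * k ≤ n := by exact_mod_cast hJk
      calc (J.card : ℝ) * (ε * k * d ^ h) = ε * (J.card * k) * d ^ h := by ring
        _ ≤ ε * n * d ^ h := by gcongr
        _ = _ := by push_cast; rfl)
  have hz0 : ¬ (D 0).card ≤ 4 * ((D 0).filter fun w => ξ w ω = 0).card := by
    intro hle
    have himg : (D 0).image (cell ((2 ^ a) ^ 0 : ℕ)) = D 0 := by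
      have : cell (((2 ^ a) ^ 0 : ℕ) : ℤ) = id := by
        funext z; simp [cell]
      rw [this, Finset.image_id]
    have hs := hsep' 0 (Nat.zero_le h)
    rw [himg] at hs hDtree
    exact hzero ⟨_, hzR, _, hDtree, ⟨fun x hx => hP (hDP hx),
      fun x hx y hy hxy => lt_of_lt_of_le (by omega) (hs x hx y hy hxy), hDcard⟩, hle⟩
  -- The first set has at most a quarter of the leaves and the second fewer than a quarter, so the
  -- third has at least half as many elements as there are leaves.
  have hcover : D 0 ⊆ (((D 0).filter fun x => 4 * (ε * n) < ∑ j ∈ J, max (levelSum b k {j} ω x) 0) ∪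
      ((D 0).filter fun w => ξ w ω = 0)) ∪ ((vertices P).filter fun w =>
      phi b n k w ω ≤ 4 * (ε * n) + T ∧ ξ w ω = 1) := by
    intro x hx
    simp only [Finset.mem_union, Finset.mem_filter]
    have hxP : x ∈ vertices P := hDP hx
    by_cases h1 : 4 * (ε * n) < ∑ j ∈ J, max (levelSum b k {j} ω x) 0
    · exact Or.inl (Or.inl ⟨hx, h1⟩)
    rcases hξ x (hP hxP) with h2 | h2
    · exact Or.inl (Or.inr ⟨hx, h2⟩)
    refine Or.inr ⟨hxP, ?_, h2⟩
    have h3 : phi b n k x ω = levelSum b k J ω x + levelSum b k J' ω x := by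
      unfold levelSum
      rw [← Finset.sum_union hdisj, hJJ, phi]
    have h4 : levelSum b k J ω x ≤ ∑ j ∈ J, max (levelSum b k {j} ω x) 0 := by
      rw [levelSum_eq_sum]
      exact Finset.sum_le_sum fun j _ => le_max_left _ _
    have h5 := htop x (hP hxP)
    linarith
  have hc := (Finset.card_le_card hcover).trans ((Finset.card_union_le _ _).trans
    (Nat.add_le_add_right (Finset.card_union_le _ _) _))
  omega

/-! ### Choice of parameters and numerical estimates. -/

theorem union_bound_le {r M m : ℕ} {y z : ℝ} (hy : 0 ≤ y) (hM : (M : ℝ) ^ 2 * y ≤ Real.exp (-1))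
    (hr : r * Real.exp (-(m : ℝ)) ≤ z) :
    (r : ENNReal) * ((M : ENNReal) ^ (2 * m) * ENNReal.ofReal (y ^ m)) ≤ ENNReal.ofReal z := by
  rw [← ENNReal.ofReal_natCast, ← ENNReal.ofReal_natCast, ← ENNReal.ofReal_pow (by positivity),
    ← ENNReal.ofReal_mul (by positivity), ← ENNReal.ofReal_mul (by positivity)]
  refine ENNReal.ofReal_le_ofReal (le_trans ?_ hr)
  gcongr
  calc (M : ℝ) ^ (2 * m) * y ^ m = ((M : ℝ) ^ 2 * y) ^ m := by rw [mul_pow, pow_mul]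
    _ ≤ Real.exp (-1) ^ m := by gcongr
    _ = _ := by rw [← Real.exp_nat_mul, mul_neg_one]

theorem card_V (n : ℕ) : (V n).card = 4 ^ n := by
  have h : ((2 : ℤ) ^ n - 0).toNat = 2 ^ n := by
    rw [sub_zero]; exact_mod_cast Int.toNat_natCast (2 ^ n)
  rw [V, Finset.card_product, Int.card_Ico, h, ← mul_pow]
  norm_num

theorem two_pow_le_exp (n : ℕ) : (2 : ℝ) ^ n ≤ Real.exp (0.7 * n) := by
  rw [mul_comm, Real.exp_nat_mul]
  gcongr
  rw [← Real.log_le_iff_le_exp (by norm_num)]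
  linarith [Real.log_two_lt_d9]

/-- The exponential decay beats the number of roots and levels. -/
theorem mul_four_pow_mul_exp_le {n m : ℕ} (h : 4 * n ≤ m) :
    (n + 1) * ((4 : ℝ) ^ n * Real.exp (-(m : ℝ))) ≤ Real.exp (-(n : ℝ) / 10) := by
  have h1 : (n : ℝ) + 1 ≤ Real.exp n := Real.add_one_le_exp _
  have h2 : (4 : ℝ) ^ n ≤ Real.exp (1.4 * n) := by
    have := two_pow_le_exp n
    calc (4 : ℝ) ^ n = (2 ^ n) * (2 ^ n) := by rw [← mul_pow]; norm_num
      _ ≤ Real.exp (0.7 * n) * Real.exp (0.7 * n) := by gcongr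
      _ = _ := by rw [← Real.exp_add]; congr 1; ring
  have h3 : (4 : ℝ) * n ≤ m := by exact_mod_cast h
  calc _ ≤ Real.exp n * (Real.exp (1.4 * n) * Real.exp (-(m : ℝ))) := by gcongr
    _ ≤ _ := by
      rw [← Real.exp_add, ← Real.exp_add]
      refine Real.exp_le_exp.2 ?_
      have : (0 : ℝ) ≤ n := by positivity
      linarith

theorem eventually_mul_le_two_rpow {c : ℝ} (hc : 0 < c) :
    ∀ᶠ n : ℕ in atTop, 16 * (n : ℝ) ≤ 2 ^ (c * n) := by
  have hl : 0 < Real.log 2 := Real.log_pos (by norm_num)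
  filter_upwards [tendsto_natCast_atTop_atTop.eventually_ge_atTop (32 / (Real.log 2 * c) ^ 2)]
    with n hn
  rw [Real.rpow_def_of_pos (by norm_num)]
  have h1 : 0 ≤ Real.log 2 * (c * n) := by positivity
  have h2 := Real.quadratic_le_exp_of_nonneg h1
  rw [div_le_iff₀ (by positivity)] at hn
  have h3 : (0 : ℝ) ≤ n := by positivity
  nlinarith

/-- With `d = 2 ^ a / ρ` rounded down, `2 ^ a ≤ 2 * ρ * d`; for `a` large the loss `2 * ρ` is at
most `2 ^ (a * δ / 4)`. -/
theorem exists_tree_parameters {δ : ℝ} (hδ0 : 0 < δ) (hδ1 : δ < 1) {ρ : ℕ} (hρ : 1 ≤ ρ) :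
    ∃ a d : ℕ, 0 < a ∧ 2 ≤ d ∧ d * ρ ≤ 2 ^ a ∧ (2 : ℝ) ^ (a * (1 - δ / 4)) ≤ d := by
  obtain ⟨a, ha⟩ := exists_nat_gt (4 / δ * (2 * ρ))
  have hρ' : (1 : ℝ) ≤ ρ := by exact_mod_cast hρ
  have h2ρ : 2 * (ρ : ℝ) ≤ 2 ^ (a * (δ / 4)) := by
    have h1 : 2 * (ρ : ℝ) ≤ a * (δ / 4) := by
      have : 4 / δ * (2 * ρ) * (δ / 4) ≤ a * (δ / 4) := by gcongr
      refine le_trans (le_of_eq ?_) this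
      field_simp
    have h2 := one_add_mul_self_le_rpow_one_add (s := 1) (by norm_num) (p := a * (δ / 4))
      (by linarith)
    norm_num at h2
    linarith
  have hA : 2 * (ρ : ℝ) ≤ 2 ^ a := by
    refine h2ρ.trans ?_
    rw [← Real.rpow_natCast]
    refine Real.rpow_le_rpow_of_exponent_le (by norm_num) ?_
    exact mul_le_of_le_one_right (by positivity) (by linarith)
  have hA' : 2 * ρ ≤ 2 ^ a := by exact_mod_cast hA
  have hd2 : 2 ≤ 2 ^ a / ρ := (Nat.le_div_iff_mul_le (by omega)).2 hA'
  refine ⟨a, 2 ^ a / ρ, ?_, hd2, Nat.div_mul_le_self _ _, ?_⟩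
  · have : 0 < 4 / δ * (2 * ρ) := by positivity
    exact_mod_cast this.trans ha
  · have h1 : (2 : ℝ) ^ a ≤ ρ * ((2 ^ a / ρ : ℕ) + 1) := by
      exact_mod_cast (Nat.lt_mul_div_succ (2 ^ a) (by omega : 0 < ρ)).le
    have h2 : (2 : ℝ) ≤ (2 ^ a / ρ : ℕ) := by exact_mod_cast hd2
    generalize ((2 ^ a / ρ : ℕ) : ℝ) = d at *
    have h3 : (2 : ℝ) ^ (a * (1 - δ / 4)) * 2 ^ (a * (δ / 4)) = 2 ^ a := by
      rw [← Real.rpow_add (by norm_num), ← Real.rpow_natCast]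
      congr 1
      ring
    have h4 : 0 < (2 : ℝ) ^ (a * (1 - δ / 4)) := by positivity
    have h5 : (2 : ℝ) ^ (a * (1 - δ / 4)) * (2 * ρ) ≤ d * (2 * ρ) := by
      calc _ ≤ (2 : ℝ) ^ (a * (1 - δ / 4)) * 2 ^ (a * (δ / 4)) := by gcongr
        _ = 2 ^ a := h3
        _ ≤ ρ * (d + 1) := h1
        _ ≤ ρ * (d + d) := by gcongr; linarith
        _ = _ := by ring
    exact le_of_mul_le_mul_right h5 (by positivity)

theorem exists_dist_of_le_diam {u v : ℤ × ℤ} (P : grid.Walk u v) {s : ℕ} (h : s ≤ diam P) :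
    ∃ z ∈ vertices P, ∃ y ∈ vertices P, s ≤ supDist z y := by
  have hne : (vertices P ×ˢ vertices P).Nonempty :=
    ⟨(u, u), Finset.mem_product.2 ⟨by simp [vertices], by simp [vertices]⟩⟩
  obtain ⟨e, he, hmax⟩ := Finset.exists_mem_eq_sup _ hne fun e => supDist e.1 e.2
  rw [Finset.mem_product] at he
  exact ⟨e.1, he.1, e.2, he.2, by rw [← hmax]; exact h⟩

/-- The top levels contribute little, except with exponentially small probability. -/
theorem eventually_top_bound {δ : ℝ} (hδ0 : 0 < δ) (hδ1 : δ < 1) (k : ℕ) :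
    ∀ᶠ n : ℕ in atTop, ∀ (j₀ N : ℕ), (1 - δ ^ 2 / 2) * n ≤ j₀ * k →
      (N : ℝ) * k ≤ δ ^ 2 / 2 * n →
      ((2 : ℝ) ^ n / 2 ^ (j₀ * k) + 1) ^ 2 *
        ((1 / 2 * Real.exp (2 * (1 / δ) ^ 2 * k * N) + 2048 *
          (1 + Real.exp (128 * k * (1 / δ) ^ 2))) *
          Real.exp (-(1 / δ * (2 * δ * n)))) ≤ Real.exp (-(n : ℝ) / 10) := by
  set C := 2048 * (1 + Real.exp (128 * k * (1 / δ) ^ 2)) with hC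
  have hCpos : 0 < C := by positivity
  filter_upwards [tendsto_natCast_atTop_atTop.eventually_ge_atTop (5 * Real.log (2 + 4 * C))]
    with n hn j₀ N hj hN
  have hn0 : (0 : ℝ) ≤ n := by positivity
  have hδ2 : δ ^ 2 ≤ 1 := by nlinarith
  have h1 : (2 : ℝ) ^ n / 2 ^ (j₀ * k) ≤ Real.exp (0.35 * n) := by
    rw [← Real.rpow_natCast, ← Real.rpow_natCast, ← Real.rpow_sub (by norm_num),
      Real.rpow_def_of_pos (by norm_num)]
    refine Real.exp_le_exp.2 ?_
    push_cast
    have h2 : (n : ℝ) - j₀ * k ≤ 1 / 2 * n := by nlinarith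
    have h3 := Real.log_two_lt_d9
    have h4 := Real.log_two_gt_d9
    nlinarith
  have h2 : (1 : ℝ) ≤ Real.exp (0.35 * n) := Real.one_le_exp (by positivity)
  have h3 : Real.exp (2 * (1 / δ) ^ 2 * k * N) ≤ Real.exp n := by
    refine Real.exp_le_exp.2 ?_
    calc 2 * (1 / δ) ^ 2 * k * N = 2 * (1 / δ) ^ 2 * (N * k) := by ring
      _ ≤ 2 * (1 / δ) ^ 2 * (δ ^ 2 / 2 * n) := by gcongr
      _ = n := by field_simp
  have h4 : C ≤ C * Real.exp n := le_mul_of_one_le_right hCpos.le (Real.one_le_exp hn0)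
  have h5 : 2 + 4 * C ≤ Real.exp (0.2 * n) := by
    rw [← Real.log_le_iff_le_exp (by positivity)]
    linarith
  calc _ ≤ (Real.exp (0.35 * n) + Real.exp (0.35 * n)) ^ 2 *
        ((1 / 2 * Real.exp n + C * Real.exp n) * Real.exp (-(1 / δ * (2 * δ * n)))) := by gcongr
    _ = (2 + 4 * C) * (Real.exp (0.35 * n) * Real.exp (0.35 * n) * Real.exp n *
        Real.exp (-(1 / δ * (2 * δ * n)))) := by ring
    _ ≤ Real.exp (0.2 * n) * (Real.exp (0.35 * n) * Real.exp (0.35 * n) * Real.exp n *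
        Real.exp (-(1 / δ * (2 * δ * n)))) := by gcongr
    -- The exponents add up to `0.2 + 0.35 + 0.35 + 1 - 2 = -0.1`.
    _ = _ := by
      rw [← Real.exp_add, ← Real.exp_add, ← Real.exp_add, ← Real.exp_add]
      congr 1
      field_simp
      ring

/-- For large `n` the trees have many vertices at all the scales that matter. -/
theorem eventually_tree_size {δ κ : ℝ} (hδ0 : 0 < δ) (hδ1 : δ < 1) (hκ : κ < δ ^ 2 / 2)
    {a d : ℕ} (ha : 0 < a) (hd : 2 ≤ d) (had : (2 : ℝ) ^ (a * (1 - δ / 4)) ≤ d) :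
    ∀ᶠ n : ℕ in atTop, ∃ h : ℕ, (((2 ^ a) ^ h : ℕ) : ℝ) ≤ ((2 : ℝ) ^ n) ^ (1 - κ) ∧
      2 * ((2 : ℝ) ^ n) ^ (1 - δ) ≤ (d ^ h : ℕ) ∧
      ∀ i : ℕ, (a : ℝ) * i ≤ (1 - δ ^ 2 / 2) * n + a → i ≤ h ∧ 4 * n ≤ d ^ (h - i) := by
  have ha' : (0 : ℝ) < a := by exact_mod_cast ha
  have hc : 0 < (δ ^ 2 / 2 - κ) / a := div_pos (by linarith) ha'
  have hδ2 : δ ^ 2 ≤ δ := by nlinarith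
  filter_upwards [eventually_mul_le_two_rpow hc, eventually_ge_atTop 1,
    tendsto_natCast_atTop_atTop.eventually_ge_atTop (4 / δ * (a + 1))] with n hn hn1 hnδ
  have hn1' : (1 : ℝ) ≤ n := by exact_mod_cast hn1
  -- The largest depth whose scale `(2 ^ a) ^ h` does not exceed `N ^ (1 - κ)`.
  set h := ⌊(1 - κ) * n / a⌋₊ with hh
  have hnn : 0 ≤ (1 - κ) * n / a := by
    have : 0 ≤ 1 - κ := by nlinarith
    positivity
  have hle : (a : ℝ) * h ≤ (1 - κ) * n := by
    rw [mul_comm]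
    exact (le_div_iff₀ ha').1 (Nat.floor_le hnn)
  have hlt : (1 - κ) * n < a * h + a := by
    have := Nat.lt_floor_add_one ((1 - κ) * n / a)
    rw [div_lt_iff₀ ha', ← hh] at this
    linarith
  refine ⟨h, ?_, ?_, fun i hi => ?_⟩
  · push_cast
    rw [← pow_mul, ← Real.rpow_natCast, ← Real.rpow_natCast, ← Real.rpow_mul (by norm_num)]
    refine Real.rpow_le_rpow_of_exponent_le (by norm_num) ?_
    push_cast
    linarith
  · push_cast
    calc 2 * ((2 : ℝ) ^ n) ^ (1 - δ) = 2 ^ (1 + n * (1 - δ)) := by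
          rw [Real.rpow_add (by norm_num), Real.rpow_one, Real.rpow_mul (by norm_num),
            Real.rpow_natCast]
      _ ≤ 2 ^ (a * (1 - δ / 4) * h) := by
          refine Real.rpow_le_rpow_of_exponent_le (by norm_num) ?_
          have h1 : (1 - δ / 2) * n - a ≤ a * h := by nlinarith
          have h2 : (1 - δ / 4) * ((1 - δ / 2) * n - a) ≤ (1 - δ / 4) * (a * h) :=
            mul_le_mul_of_nonneg_left h1 (by linarith)
          have h3 : a + 1 ≤ δ / 4 * n := by
            have := mul_le_mul_of_nonneg_left hnδ (show 0 ≤ δ / 4 by positivity)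
            refine le_trans (le_of_eq ?_) this
            field_simp
          have h4 : 0 ≤ δ ^ 2 * n := by positivity
          have h5 : 0 ≤ δ * a := by positivity
          nlinarith
      _ = ((2 : ℝ) ^ (a * (1 - δ / 4))) ^ h := by
          rw [Real.rpow_mul (by norm_num), Real.rpow_natCast]
      _ ≤ (d : ℝ) ^ h := by gcongr
  -- Here `κ < δ ^ 2 / 2` enters: a number of generations linear in `n` lies above every scale `i`
  -- considered, so `d ^ (h - i)` is exponentially large. The `-2` collects two rounding losses of
  -- one generation each.
  · have h1 : (δ ^ 2 / 2 - κ) / a * n - 2 ≤ (h : ℝ) - i := by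
      rw [div_mul_eq_mul_div, sub_le_iff_le_add, div_le_iff₀ ha']
      nlinarith
    have h2 : (4 : ℝ) * n ≤ 2 ^ ((h : ℝ) - i) := by
      calc (4 : ℝ) * n = 16 * n / 2 ^ (2 : ℝ) := by norm_num; ring
        _ ≤ 2 ^ ((δ ^ 2 / 2 - κ) / a * n) / 2 ^ (2 : ℝ) := by gcongr
        _ = 2 ^ ((δ ^ 2 / 2 - κ) / a * n - 2) := by rw [Real.rpow_sub (by norm_num)]
        _ ≤ _ := Real.rpow_le_rpow_of_exponent_le (by norm_num) h1
    have h3 : i ≤ h := by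
      by_contra! hlt
      have h4 : (2 : ℝ) ^ ((h : ℝ) - i) ≤ 1 := by
        refine Real.rpow_le_one_of_one_le_of_nonpos (by norm_num) ?_
        have : (h : ℝ) < i := by exact_mod_cast hlt
        linarith
      linarith
    refine ⟨h3, ?_⟩
    rw [← Nat.cast_sub h3, Real.rpow_natCast] at h2
    have h4 : 4 * n ≤ 2 ^ (h - i) := by exact_mod_cast h2
    exact h4.trans (Nat.pow_le_pow_left hd _)

/-- Only subadditivity is used, so `G` need not be measurable. The bad events cost at most `x` for
`E₁`, `x` for all `E₂ j` together and `x` for `E₃`. -/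
theorem one_sub_le_measureReal {Ω : Type*} [MeasurableSpace Ω] {μ : Measure Ω}
    [IsProbabilityMeasure μ] {G E₁ E₃ : Set Ω} {J : Finset ℕ} {E₂ : ℕ → Set Ω} {n : ℕ} {x : ℝ}
    (hJ : J.card ≤ n) (hx : 0 ≤ x) (hG : Gᶜ ⊆ E₁ ∪ (⋃ j ∈ J, E₂ j) ∪ E₃)
    (h₁ : μ E₁ ≤ ENNReal.ofReal x) (h₂ : ∀ j ∈ J, μ (E₂ j) ≤ ENNReal.ofReal (x / (n + 1)))
    (h₃ : μ E₃ ≤ ENNReal.ofReal (x / (n + 1))) : 1 - 6 * x ≤ μ.real G := by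
  have hbad : μ Gᶜ ≤ ENNReal.ofReal (3 * x) := by
    calc μ Gᶜ ≤ μ E₁ + ∑ j ∈ J, μ (E₂ j) + μ E₃ :=
          (measure_mono hG).trans ((measure_union_le _ _).trans (add_le_add_left
            ((measure_union_le _ _).trans (add_le_add_right (measure_biUnion_finset_le _ _) _)) _))
      _ ≤ ENNReal.ofReal x + J.card * ENNReal.ofReal (x / (n + 1)) +
          ENNReal.ofReal (x / (n + 1)) := by
          gcongr
          rw [← nsmul_eq_mul]
          exact Finset.sum_le_card_nsmul _ _ _ h₂
      _ = ENNReal.ofReal (x + J.card * (x / (n + 1)) + x / (n + 1)) := by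
          rw [← ENNReal.ofReal_natCast, ← ENNReal.ofReal_mul (by positivity),
            ← ENNReal.ofReal_add (by positivity) (by positivity),
            ← ENNReal.ofReal_add (by positivity) (by positivity)]
      _ ≤ _ := by
          refine ENNReal.ofReal_le_ofReal ?_
          have h4 : (J.card : ℝ) ≤ n + 1 := by exact_mod_cast hJ.trans (Nat.le_succ n)
          have h5 : (J.card : ℝ) * (x / (n + 1)) ≤ x := by
            rw [mul_div_assoc', div_le_iff₀ (by positivity), mul_comm]
            gcongr
          have h6 : x / (n + 1) ≤ x := div_le_self hx (by linarith [Nat.cast_nonneg (α := ℝ) n])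
          linarith
  have hbad' : μ.real Gᶜ ≤ 3 * x := ENNReal.toReal_le_of_le_ofReal (by positivity) hbad
  have hone : (1 : ℝ) ≤ μ.real G + μ.real Gᶜ := by
    rw [← probReal_univ (μ := μ), ← Set.union_compl_self G]
    exact measureReal_union_le _ _
  linarith

end CoarseMBRW

/-! ### Assembly of the estimates. -/

theorem theorem1p2 (δ : ℝ) (hδ0 : 0 < δ) (hδ1 : δ < 1) (q : ℕ) (hq : 1 ≤ q) :
    ∃ K₀ : ℝ, 0 < K₀ ∧ ∃ p₀ : ℝ, 0 < p₀ ∧ p₀ < 1 ∧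
      ∀ κ : ℝ, 0 < κ → κ < δ ^ 2 / 2 →
      ∀ k : ℕ, 1 ≤ k → K₀ ≤ (2 : ℝ) ^ k →
      ∀ p : ℝ, p₀ ≤ p → p ≤ 1 →
      ∀ᶠ n : ℕ in atTop,
        ∀ (Ω : Type*) [MeasurableSpace Ω] (μ : Measure Ω) [IsProbabilityMeasure μ]
          (b : ℕ → ℤ × ℤ → Ω → ℝ) (ξ : ℤ × ℤ → Ω → ℕ),
          IsBoxNoise μ b → IsBernoulliField μ n q p ξ →
          IndepFun (fun ω (w : V n) => ξ w ω) (fun ω (w : V n) => phi b n k w ω) μ →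
          1 - 6 * Real.exp (-(n : ℝ) / 10) ≤
            μ.real {ω | ∀ (u v : ℤ × ℤ) (P : grid.Walk u v), vertices P ⊆ V n →
              ((2 : ℝ) ^ n) ^ (1 - κ) ≤ (diam P : ℝ) →
              ((2 : ℝ) ^ n) ^ (1 - δ) ≤
                (((vertices P).filter fun w =>
                  phi b n k w ω ≤ 4 * δ * Real.log ((2 : ℝ) ^ n) ∧ ξ w ω = 1).card : ℝ)} := by
  obtain ⟨a, d, ha, hd, hdρ, had⟩ := exists_tree_parameters hδ0 hδ1 (ρ := q + 6) (by omega)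
  set M : ℕ := 9 * (2 ^ a) ^ 2 with hM
  have hM1 : (1 : ℝ) ≤ M := by
    exact_mod_cast (show 1 ≤ 9 * (2 ^ a) ^ 2 from Nat.mul_pos (by norm_num) (by positivity))
  -- With this `ε` the total height is `4 * ε + 2 * δ = 8 * δ / 3` times `n`, below `4 * δ * log 2`
  -- times `n`.
  set ε : ℝ := δ / 6 with hε
  -- The minimiser of `128 * θ ^ 2 - θ * ε`, with minimum `-ε ^ 2 / 512`.
  set θ : ℝ := ε / 256 with hθ
  have hε0 : 0 < ε := by positivity
  have hθ0 : 0 < θ := by positivity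
  -- Cost per cell: tree entropy `M ^ 2` times the prefactor of the moment bound, where `r ≤ 2 ^ a`.
  -- It depends on `δ` and `q` only, so a large `k` beats it.
  set W : ℝ := (M : ℝ) ^ 2 * (40000 * (2 ^ a) ^ 2) with hW
  have hW0 : 0 < W := by positivity
  -- Chosen so that entropy times failure factor, `M ^ 2 * (2 * η)`, equals `exp (-1)`; then `p₀ = 1
  -- - η ^ 4`.
  set η : ℝ := Real.exp (-1) / (2 * (M : ℝ) ^ 2) with hη
  have hη0 : 0 < η := by positivity
  have hη1 : η < 1 := by
    rw [hη, div_lt_one (by positivity)]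
    have h1 : Real.exp (-1) < 1 :=
      (Real.exp_lt_exp.2 (by norm_num)).trans_eq Real.exp_zero
    nlinarith
  obtain ⟨k₀, hk₀⟩ := exists_nat_ge (512 * (1 + Real.log W) / ε ^ 2)
  refine ⟨2 ^ k₀, by positivity, 1 - η ^ 4, ?_, ?_, ?_⟩
  · linarith [pow_lt_one₀ hη0.le hη1 (n := 4) (by norm_num)]
  · linarith [pow_pos hη0 4]
  intro κ hκ0 hκ k hk hKk p hp hp1
  have hk' : k₀ ≤ k := (pow_le_pow_iff_right₀ (by norm_num : (1 : ℝ) < 2)).1 hKk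
  have hWk : W * Real.exp (128 * k * θ ^ 2 - θ * (ε * k)) ≤ Real.exp (-1) := by
    have h1 : 512 * (1 + Real.log W) ≤ k * ε ^ 2 := by
      rw [← div_le_iff₀ (by positivity)]
      exact hk₀.trans (by exact_mod_cast hk')
    nth_rewrite 1 [← Real.exp_log hW0]
    rw [← Real.exp_add]
    refine Real.exp_le_exp.2 ?_
    rw [hθ]
    linarith
  filter_upwards [eventually_ge_atTop 1, eventually_top_bound hδ0 hδ1 k,
    eventually_tree_size hδ0 hδ1 hκ ha hd had] with n hn hntop hntree
  intro Ω _ μ _ b ξ hb hξ _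
  obtain ⟨h, hdiam, hcount, htree⟩ := hntree
  have hδ2 : δ ^ 2 / 2 ≤ 1 / 2 := by nlinarith
  have hn1 : (1 : ℝ) ≤ n := by exact_mod_cast hn
  set y : ℝ := (1 - δ ^ 2 / 2) * n / k with hy
  have hk0 : (0 : ℝ) < k := by exact_mod_cast hk
  have hy0 : 0 ≤ y := by
    have : 0 ≤ 1 - δ ^ 2 / 2 := by linarith
    positivity
  set j₀ : ℕ := ⌊y⌋₊ + 1 with hj₀
  set J := (Finset.range (n / k)).filter (· < j₀) with hJ
  set J' := (Finset.range (n / k)).filter (¬ · < j₀) with hJ'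
  set R := (V n).image (cell ((2 ^ a) ^ h : ℕ)) with hR
  -- The first tree scale strictly above the box side `2 ^ (j * k)`, exceeding it by a factor of at
  -- most `2 ^ a`.
  set i : ℕ → ℕ := fun j => j * k / a + 1 with hidef
  have hi1 : ∀ j, j * k ≤ a * i j := fun j => (Nat.lt_mul_div_succ (j * k) ha).le
  have hi2 : ∀ j, a * i j ≤ j * k + a := fun j => by
    rw [hidef, mul_add, mul_one]
    exact Nat.add_le_add_right (Nat.mul_div_le _ _) _
  have hJi : ∀ j ∈ J, i j ≤ h ∧ 4 * n ≤ d ^ (h - i j) := by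
    intro j hj
    refine htree _ ?_
    have h1 : (a : ℝ) * i j ≤ j * k + a := by exact_mod_cast hi2 j
    have h2 : (j : ℝ) ≤ y := by
      have h3 : j ≤ ⌊y⌋₊ := by have := (Finset.mem_filter.1 hj).2; omega
      exact (Nat.cast_le.2 h3).trans (Nat.floor_le hy0)
    have h3 := (le_div_iff₀ hk0).1 h2
    linarith
  have hh4 : 4 * n ≤ d ^ h := by
    have := (htree 0 (by
      have : 0 ≤ 1 - δ ^ 2 / 2 := by linarith
      push_cast
      rw [mul_zero]
      positivity)).2
    simpa using this
  have hRcard : (R.card : ℝ) ≤ 4 ^ n := by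
    exact_mod_cast Finset.card_image_le.trans_eq (card_V n)
  have hfew : ∀ m : ℕ, 4 * n ≤ m →
      (R.card : ℝ) * Real.exp (-(m : ℝ)) ≤ Real.exp (-(n : ℝ) / 10) / (n + 1) := by
    intro m hm
    rw [le_div_iff₀ (by positivity), mul_comm _ ((n : ℝ) + 1)]
    refine le_trans ?_ (mul_four_pow_mul_exp_le hm)
    gcongr
  set Etop : Set Ω := {ω | ∃ z ∈ V n, 2 * δ * n ≤ levelSum b k J' ω z} with hEtop
  set Elow : ℕ → Set Ω := fun j => {ω | ∃ c ∈ R, ∃ C ∈ trees (2 ^ a) d (h - i j) c,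
      ((∀ x ∈ C, ∀ y ∈ C, x ≠ y → 4 ≤ supDist x y) ∧ C.card = d ^ (h - i j)) ∧
      ω ∈ {ω | Real.exp (θ * (ε * k) * C.card) ≤
        ∏ c ∈ C, regionBound θ (j * k) (2 ^ (a * i j - j * k)) (levelSum b k {j} ω) c}} with hElow
  set Ezero : Set Ω := {ω | ∃ c ∈ R, ∃ C ∈ trees (2 ^ a) d h c,
      (C ⊆ V n ∧ (∀ x ∈ C, ∀ y ∈ C, x ≠ y → q < supDist x y) ∧ C.card = d ^ h) ∧
      ω ∈ {ω | C.card ≤ 4 * (C.filter fun w => ξ w ω = 0).card}} with hEzero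
  have hPtop : μ Etop ≤ ENNReal.ofReal (Real.exp (-(n : ℝ) / 10)) := by
    refine (hb.measure_exists_le_levelSum_le hk (j₀ := j₀) (fun j hj => ?_) n
      (θ := 1 / δ) (by positivity) (2 * δ * n)).trans (ENNReal.ofReal_le_ofReal ?_)
    · exact not_lt.1 (Finset.mem_filter.1 hj).2
    · have h1 : (1 - δ ^ 2 / 2) * n ≤ j₀ * k := by
        rw [← div_le_iff₀ hk0, hj₀]
        push_cast
        exact (Nat.lt_floor_add_one y).le
      refine hntop j₀ J'.card h1 ?_
      have h2 : J'.card ≤ n / k - j₀ := by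
        rw [← Nat.card_Ico]
        refine Finset.card_le_card fun j hj => ?_
        rw [hJ', Finset.mem_filter, Finset.mem_range] at hj
        exact Finset.mem_Ico.2 ⟨not_lt.1 hj.2, hj.1⟩
      rcases le_total (n / k) j₀ with h3 | h3
      · rw [Nat.sub_eq_zero_of_le h3, Nat.le_zero] at h2
        rw [h2, Nat.cast_zero, zero_mul]
        positivity
      · have h4 : (J'.card : ℝ) ≤ (n / k : ℕ) - j₀ := by
          rw [← Nat.cast_sub h3]; exact_mod_cast h2
        have h5 : ((n / k : ℕ) : ℝ) * k ≤ n := by exact_mod_cast Nat.div_mul_le_self n k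
        calc (J'.card : ℝ) * k ≤ ((n / k : ℕ) - j₀) * k := by gcongr
          _ ≤ _ := by linarith
  have hPlow : ∀ j ∈ J, μ (Elow j) ≤ ENNReal.ofReal (Real.exp (-(n : ℝ) / 10) / (n + 1)) := by
    intro j hj
    refine (measure_exists_trees_le (by positivity) hd _ R _ _ (ENNReal.ofReal
      ((40000 * (2 ^ (a * i j - j * k) : ℕ) ^ 2 * Real.exp (128 * k * θ ^ 2 - θ * (ε * k))) ^
        d ^ (h - i j))) fun C hC => ?_).trans
      (union_bound_le (by positivity) ?_ (hfew _ (hJi j hj).2))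
    · rw [← hC.2]
      exact hb.measure_le_prod_regionBound_le hk (by positivity) j θ _ hC.1
    · refine le_trans ?_ hWk
      rw [hW, ← mul_assoc]
      gcongr
      · push_cast
        have h1 : (2 : ℝ) ^ (a * i j - j * k) ≤ 2 ^ a :=
          pow_le_pow_right₀ (by norm_num) (by have := hi2 j; omega)
        gcongr
  have hPzero : μ Ezero ≤ ENNReal.ofReal (Real.exp (-(n : ℝ) / 10) / (n + 1)) := by
    refine (measure_exists_trees_le (by positivity) hd _ R _ _ (ENNReal.ofReal
      ((2 * η) ^ d ^ h)) fun C hC => ?_).trans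
      (union_bound_le (by positivity) (le_of_eq ?_) (hfew _ hh4))
    · rw [← hC.2.2]
      exact hξ.measure_card_zeros_le hη0.le hη1.le (by linarith) hC.1 hC.2.1
    · rw [hη, ← hM]
      field_simp
  set G : Set Ω := {ω | ∀ (u v : ℤ × ℤ) (P : grid.Walk u v), vertices P ⊆ V n →
      ((2 : ℝ) ^ n) ^ (1 - κ) ≤ (diam P : ℝ) →
      ((2 : ℝ) ^ n) ^ (1 - δ) ≤ (((vertices P).filter fun w =>
        phi b n k w ω ≤ 4 * δ * Real.log ((2 : ℝ) ^ n) ∧ ξ w ω = 1).card : ℝ)} with hG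
  have hJcard : J.card ≤ n / k := (Finset.card_filter_le _ _).trans_eq (Finset.card_range _)
  have hsub : Gᶜ ⊆ Etop ∪ (⋃ j ∈ J, Elow j) ∪ Ezero := by
    intro ω hω
    by_contra hcon
    simp only [Set.mem_union, Set.mem_iUnion, not_or, not_exists] at hcon
    obtain ⟨⟨hc1, hc2⟩, hc3⟩ := hcon
    refine hω fun u v P hP hPdiam => ?_
    obtain ⟨z, hz, w, hw, hzw⟩ := exists_dist_of_le_diam P (s := (2 ^ a) ^ h)
      (by exact_mod_cast hdiam.trans hPdiam)
    have key := half_le_card_filter (b := b) (ξ := ξ) (ω := ω) (n := n) (k := k) (q := q)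
      (T := 2 * δ * n) (J := J) (J' := J') (i := i) (R := R) hn hε0 hθ0 (by omega) (by omega) hdρ
      ((Nat.mul_le_mul_right k hJcard).trans (Nat.div_mul_le_self n k))
      (Finset.disjoint_filter_filter_not _ _ _) (Finset.filter_union_filter_not_eq _ _)
      (fun j hj => ⟨(hJi j hj).1, hi1 j⟩) (fun z hz => Finset.mem_image_of_mem _ hz)
      (fun w hw => hξ.zero_or_one w hw ω)
      (fun z hz => not_le.1 fun hle => hc1 ⟨z, hz, hle⟩)
      (fun j hj => hc2 j hj) hc3 P hP hz hw hzw
    have hmono : ((vertices P).filter fun w =>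
        phi b n k w ω ≤ 4 * (ε * n) + 2 * δ * n ∧ ξ w ω = 1).card ≤
        ((vertices P).filter fun w =>
        phi b n k w ω ≤ 4 * δ * Real.log ((2 : ℝ) ^ n) ∧ ξ w ω = 1).card := by
      refine Finset.card_le_card (Finset.monotone_filter_right _ fun w _ hw => ⟨hw.1.trans ?_, hw.2⟩)
      rw [Real.log_pow, hε]
      have h1 := Real.log_two_gt_d9
      have h2 : 0 < δ * n := by positivity
      nlinarith
    have key' : ((d ^ h : ℕ) : ℝ) ≤ 2 * ((vertices P).filter fun w =>
        phi b n k w ω ≤ 4 * δ * Real.log ((2 : ℝ) ^ n) ∧ ξ w ω = 1).card := by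
      exact_mod_cast key.trans (Nat.mul_le_mul_left 2 hmono)
    linarith
  exact one_sub_le_measureReal (hJcard.trans (Nat.div_le_self n k)) (Real.exp_pos _).le hsub
    hPtop hPlow hPzero
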